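/- Let $w>0$, $\mu\ge 0$, $L\ge 2$. Diffusion-limited pair annihilation and deposition on the torus $\mathbb Z/L\mathbb Z$ with jump rate $w$ and deposition rate $\mu$, together with its activity, is the continuous-time Markov chain $(\eta(t),A(t))$ on $\{0,1\}^{\mathbb Z/L\mathbb Z}\times\mathbb N_0$ with generator $$(\tilde{\mathcal H}f)(\eta,A)=\sum_{k\in\mathbb Z/L\mathbb Z}\Big[\mu f(\bar\eta^{k},A)+w(\eta_k+\eta_{k+1})f(\bar\eta^{k},A+1)-\big(\mu+w(\eta_k+\eta_{k+1})\big)f(\eta,A)\Big],$$ where $\bar\eta^{k}$ is $\eta$ with the occupation numbers at sites $k$ and $k+1$ both flipped ($0\leftrightarrow1$). The parity of the particle number $\sum_k\eta_k$ is conserved. Write $\mathbb E_{\eta}$ for the expectation of the process started in $(\eta,0)$. Take $w=\tfrac12$ and $\mu=\tfrac{1-\nu}{2}$ with $0\le\nu\le1$, and let $s_c=\ln(1-\mu/w)=\ln\nu$ (for $\nu=0$: $s_c=-\infty$, with $\mathrm e^{s_cA}=1$ if $A=0$ and $\mathrm e^{s_cA}=0$ if $A\ge1$). **Proposition.** Fix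 $\nu\in[0,1]$. For every $L\ge2$ the limiting cumulant generating function of the activity per site and unit time at the critical point $s_c$, $$K_L^{\pm}(s_c)=\lim_{t\to\infty}\frac1{Lt}\ln\mathbb E_\eta\big[\mathrm e^{s_cA(t)}\big],$$ exists and takes the same value for all initial configurations $\eta$ with an even ($+$), respectively odd ($-$), number of particles; and, as $L\to\infty$, $$K_L^{+}(s_c)=\kappa_0^*+\frac1\xi\,\frac{\pi c}{6L^2}+O(L^{-4}),\qquad K_L^{-}(s_c)=\kappa_0^*-\frac1\xi\,\frac{\pi c}{3L^2}+O(L^{-3}),$$ where the implied constants may depend on $\nu$, and $$\kappa_0^*=\frac\nu2-1+\frac1\pi\Big(\frac{\arcsin\nu}{\nu}+\sqrt{1-\nu^2}\Big),\qquad \xi=\frac1{\sqrt{1-\nu^2}},\qquad c=\frac12,$$ with the limit values $\frac{\arcsin\nu}{\nu}=1$ at $\nu=0$ and $\frac1\xi=0$ at $\nu=1$. -/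

import Mathlib

open Filter Topology Asymptotics

namespace DLPAD

noncomputable section

/-- Configurations of at most one particle per site on the discrete torus `ℤ / Lℤ`;
`η k = true` means that site `k` is occupied. -/
abbrev Config (L : ℕ) : Type := Fin L → Bool

/-- The occupation number `η_k ∈ {0, 1}`. -/
def occ {L : ℕ} (η : Config L) (k : Fin L) : ℕ := if η k then 1 else 0

/-- The total particle number `N(η)`. -/
def particleNumber {L : ℕ} (η : Config L) : ℕ := ∑ k, occ η k

/-- The configuration in which the two sites `k` and `k + 1` (modulo `L`) are flipped;
`finRotate L` is the map `k ↦ k + 1` modulo `L`. -/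
def flip {L : ℕ} (η : Config L) (k : Fin L) : Config L :=
  fun j => if j = k ∨ j = finRotate L k then !(η j) else η j

/-- States `(η, A)` of the joint process of the configuration and the activity. -/
abbrev JointState (L : ℕ) : Type := Config L × ℕ

/-- The generator of the joint process with jump rate `w` and deposition rate `μ`: the bond
`(k, k + 1)` is flipped with rate `μ` without change of the activity, and with rate
`w (η_k + η_{k+1})` with an increment of the activity by `1`. -/
def jointGenerator (L : ℕ) (w μ : ℝ) : (JointState L → ℝ) →ₗ[ℝ] (JointState L → ℝ) where
  toFun f x := ∑ k : Fin L,
    (μ * f (flip x.1 k, x.2)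
      + w * ((occ x.1 k : ℝ) + occ x.1 (finRotate L k)) * f (flip x.1 k, x.2 + 1)
      - (μ + w * ((occ x.1 k : ℝ) + occ x.1 (finRotate L k))) * f x)
  map_add' f g := by
    funext x
    simp only [Pi.add_apply, ← Finset.sum_add_distrib]
    exact Finset.sum_congr rfl fun k _ => by ring
  map_smul' c f := by
    funext x
    simp only [Pi.smul_apply, smul_eq_mul, RingHom.id_apply, Finset.mul_sum]
    exact Finset.sum_congr rfl fun k _ => by ring

/-- The transition probability `p_t(x, y) = (exp (t 𝓖) 1_{y}) (x)` of the joint process. The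
rates are bounded, so that the exponential series converges absolutely. -/
def transitionProb (L : ℕ) (w μ t : ℝ) (x y : JointState L) : ℝ :=
  ∑' n : ℕ, t ^ n / (n.factorial : ℝ) * ((jointGenerator L w μ ^ n) (Pi.single y 1)) x

/-- The moment generating function `𝔼_{η,0} [exp (s A(t))]` of the activity at time `t`, started
from the configuration `η` with activity `0`. The Legendre parameter `s` may be `-∞ = ⊥`, with
`exp (-∞ * A) = 1` if `A = 0` and `0` if `A ≥ 1`. -/
def activityMGF (L : ℕ) (w μ : ℝ) (η : Config L) (s : EReal) (t : ℝ) : ℝ :=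
  ∑' y : JointState L,
    transitionProb L w μ t (η, 0) y * (EReal.exp (s * (y.2 : EReal))).toReal

/-- `κ` is the limiting cumulant generating function per site and unit time,
`lim_{t → ∞} (1 / (L t)) log 𝔼_{η,0} [exp (s A(t))]`, for every initial configuration `η`
whose particle number has the parity `sector` (`Even` or `Odd`). -/
def IsCumulantGF (L : ℕ) (w μ : ℝ) (s : EReal) (sector : ℕ → Prop) (κ : ℝ) : Prop :=
  ∀ η : Config L, sector (particleNumber η) →
    Tendsto (fun t : ℝ => Real.log (activityMGF L w μ η s t) / (L * t)) atTop (𝓝 κ)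

/-- The critical point `s_c = log (1 - μ / w)`, equal to `-∞` for `μ = w`. -/
def criticalPoint (w μ : ℝ) : EReal := ENNReal.log (ENNReal.ofReal (1 - μ / w))

/-- `κ*_0 = ν / 2 - 1 + (arcsin ν / ν + √(1 - ν²)) / π`, where `arcsin ν / ν` takes its limit
value `1` at `ν = 0`. -/
def kappaStar (ν : ℝ) : ℝ :=
  ν / 2 - 1 + 1 / Real.pi *
    ((if ν = 0 then 1 else Real.arcsin ν / ν) + Real.sqrt (1 - ν ^ 2))

/-- The sound velocity `ξ = 1 / √(1 - ν²)`. It enters only through `1 / ξ`, which is `√(1 - ν²)`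
for all `0 ≤ ν ≤ 1`, including the value `0` at `ν = 1`, where `ξ` is infinite. -/
def soundVelocity (ν : ℝ) : ℝ := 1 / Real.sqrt (1 - ν ^ 2)

/-- The central charge of the Ising universality class. -/
def centralCharge : ℝ := 1 / 2

end

end DLPAD

/-!
Since `exp s_c = ν`, the generating function of the activity is driven by a generator tilted by `ν`,
and conjugation by `d ^ N` with `d ^ 2 = √((1 + ν) / (1 - ν))` turns it into the symmetric
Hamiltonian of an XY chain. By Perron–Frobenius in each parity sector, the growth rate is the
largest eigenvalue of this Hamiltonian.

In terms of the Jordan–Wigner Majorana operators the Hamiltonian is a quadratic form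
`∑ i M_{jk} a_j b_k`, with antiperiodic fermions for even and periodic fermions for odd particle
number. The maximum of such a form over both fermion parities is the trace norm of the circulant
matrix `M`, hence a sum over momenta. The parity of the maximizing state is decided without
computing it: the zero mode of the periodic chain can be filled or emptied at no cost, and
antiperiodic boundary terms never exceed periodic ones on nonnegative functions.

At the critical point the dispersion relation is smooth on the closed interval `[0, 1]` and vanishes
at its ends, so the momentum sums are trapezoidal and midpoint sums, whose corrections of order
`L⁻²` are given by the derivatives at the ends.
-/

namespace DLPAD

noncomputable section

section Hopping

variable {X κ : Type*} [Fintype κ]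

/-- The operator `f ↦ ∑ k, r k * (f ∘ F k) - D * f` on functions of a state `x : X`. It is the
(backward) generator of a jump process if `D` is the sum of the rates `r k`; signed amplitudes
`r k` and other functions `D` are allowed so as to include tilted and gauge-twisted generators. -/
def hopping (F : κ → X → X) (r : κ → X → ℝ) (D : X → ℝ) : Module.End ℝ (X → ℝ) :=
  ∑ k, LinearMap.mulLeft ℝ (r k) ∘ₗ LinearMap.funLeft ℝ ℝ (F k) - LinearMap.mulLeft ℝ D

lemma hopping_apply (F : κ → X → X) (r : κ → X → ℝ) (D : X → ℝ) (f : X → ℝ) (x : X) :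
    hopping F r D f x = ∑ k, r k x * f (F k x) - D x * f x := by
  simp [hopping, LinearMap.funLeft_apply, LinearMap.sum_apply]

/-- The action of `exp (t H)` on functions, as a pointwise exponential series. -/
def expAction (H : Module.End ℝ (X → ℝ)) (t : ℝ) (f : X → ℝ) (x : X) : ℝ :=
  ∑' n : ℕ, t ^ n / (n.factorial : ℝ) * (H ^ n) f x

variable [DecidableEq X]

lemma hasSum_hopping_pow_single (F : κ → X → X) (r : κ → X → ℝ) (D : X → ℝ) (n : ℕ)
    (f : X → ℝ) (x : X) :
    HasSum (fun y => (hopping F r D ^ n) (Pi.single y 1) x * f y) ((hopping F r D ^ n) f x) := by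
  induction n generalizing x with
  | zero =>
    simpa using hasSum_single (f := fun y => (Pi.single y (1 : ℝ) : X → ℝ) x * f y) x
      fun y hy => by simp [Pi.single_eq_of_ne hy.symm]
  | succ n ih =>
    simp only [pow_succ', Module.End.mul_apply, hopping_apply F r D ((hopping F r D ^ n) _),
      sub_mul, Finset.sum_mul, mul_assoc]
    exact (hasSum_sum fun k _ => (ih (F k x)).mul_left (r k x)).sub ((ih x).mul_left (D x))

lemma summable_abs_hopping_pow_single_and_tsum_le (F : κ → X → X) {r : κ → X → ℝ} {D : X → ℝ}
    {C : ℝ} (hC : ∀ x, ∑ k, |r k x| + |D x| ≤ C) (n : ℕ) (x : X) :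
    Summable (fun y => |(hopping F r D ^ n) (Pi.single y 1) x|) ∧
      ∑' y, |(hopping F r D ^ n) (Pi.single y 1) x| ≤ C ^ n := by
  induction n generalizing x with
  | zero =>
    have h : HasSum (fun y => |(Pi.single y (1 : ℝ) : X → ℝ) x|) 1 := by
      simpa using hasSum_single (f := fun y => |(Pi.single y (1 : ℝ) : X → ℝ) x|) x
        fun y hy => by simp [Pi.single_eq_of_ne hy.symm]
    exact ⟨h.summable, by simpa using h.tsum_eq.le⟩
  | succ n ih =>
    set p : X → X → ℝ := fun x y => |(hopping F r D ^ n) (Pi.single y 1) x|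
    have hp : ∀ x, HasSum (p x) (∑' y, p x y) := fun x => (ih x).1.hasSum
    have hstep : ∀ y, |(hopping F r D ^ (n + 1)) (Pi.single y 1) x| ≤
        ∑ k, |r k x| * p (F k x) y + |D x| * p x y := fun y => by
      rw [pow_succ', Module.End.mul_apply, hopping_apply]
      refine (abs_sub _ _).trans (add_le_add ?_ (abs_mul _ _).le)
      exact (Finset.abs_sum_le_sum_abs _ _).trans_eq (Finset.sum_congr rfl fun k _ => abs_mul _ _)
    have hsum := (hasSum_sum fun k (_ : k ∈ Finset.univ) => (hp (F k x)).mul_left |r k x|).add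
      ((hp x).mul_left |D x|)
    have hsummable := Summable.of_nonneg_of_le (fun _ => abs_nonneg _) hstep hsum.summable
    have hCn : 0 ≤ C ^ n := (tsum_nonneg fun _ => abs_nonneg _).trans (ih x).2
    refine ⟨hsummable, ?_⟩
    calc ∑' y, |(hopping F r D ^ (n + 1)) (Pi.single y 1) x|
        ≤ ∑ k, |r k x| * ∑' y, p (F k x) y + |D x| * ∑' y, p x y :=
          (hsummable.tsum_le_tsum hstep hsum.summable).trans_eq hsum.tsum_eq
      _ ≤ ∑ k, |r k x| * C ^ n + |D x| * C ^ n := by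
          gcongr
          exacts [(ih _).2, (ih _).2]
      _ ≤ C ^ (n + 1) := by
          rw [← Finset.sum_mul, ← add_mul, pow_succ']
          exact mul_le_mul_of_nonneg_right (hC x) hCn

/-- The sums over states and over powers of the operator may be exchanged because the rates are
bounded. -/
theorem tsum_expAction_single_mul {F : κ → X → X} {r : κ → X → ℝ} {D : X → ℝ} {C B : ℝ}
    (hC : ∀ x, ∑ k, |r k x| + |D x| ≤ C) {f : X → ℝ} (hf : ∀ y, |f y| ≤ B) (t : ℝ) (x : X) :
    ∑' y, expAction (hopping F r D) t (Pi.single y 1) x * f y =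
      expAction (hopping F r D) t f x := by
  set p : ℕ → X → ℝ := fun n y => (hopping F r D ^ n) (Pi.single y 1) x
  have hp := fun n => summable_abs_hopping_pow_single_and_tsum_le F hC n x
  have hbound : Summable fun q : ℕ × X => |t| ^ q.1 / (q.1.factorial : ℝ) * |p q.1 q.2| := by
    refine (summable_prod_of_nonneg fun q => by positivity).2
      ⟨fun n => (hp n).1.mul_left (|t| ^ n / (n.factorial : ℝ)), ?_⟩
    refine .of_nonneg_of_le (fun n => tsum_nonneg fun y => by positivity) (fun n => ?_)
      (Real.summable_pow_div_factorial (|t| * C))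
    simp only [tsum_mul_left, mul_pow, mul_div_right_comm]
    exact mul_le_mul_of_nonneg_left (hp n).2 (by positivity)
  have hsummable :
      Summable fun q : ℕ × X => t ^ q.1 / (q.1.factorial : ℝ) * p q.1 q.2 * f q.2 := by
    refine .of_norm_bounded (hbound.mul_right B) fun q => ?_
    rw [Real.norm_eq_abs, abs_mul, abs_mul, abs_div, abs_pow, Nat.abs_cast]
    exact mul_le_mul_of_nonneg_left (hf _) (by positivity)
  simp only [expAction, ← tsum_mul_right]
  rw [Summable.tsum_comm (f := fun n y => t ^ n / (n.factorial : ℝ) * p n y * f y) hsummable]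
  refine tsum_congr fun n => ?_
  rw [← (hasSum_hopping_pow_single F r D n f x).tsum_eq, ← tsum_mul_left]
  exact tsum_congr fun y => mul_assoc _ _ _

end Hopping

section ActivityMGF

variable {L : ℕ} {w μ a : ℝ}

/-- The total rate at which a configuration is left. -/
def exitRate (w μ : ℝ) (η : Config L) : ℝ :=
  ∑ k, (μ + w * ((occ η k : ℝ) + occ η (finRotate L k)))

/-- The tilted generator: every jump that increases the activity carries an extra weight `a`. -/
def tiltedGenerator (L : ℕ) (w μ a : ℝ) : Module.End ℝ (Config L → ℝ) :=
  hopping (fun k η => flip η k)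
    (fun k η => μ + w * a * ((occ η k : ℝ) + occ η (finRotate L k))) (exitRate w μ)

lemma jointGenerator_eq_hopping (L : ℕ) (w μ : ℝ) :
    jointGenerator L w μ = hopping
      (Sum.elim (fun k x => (flip x.1 k, x.2)) fun k x => (flip x.1 k, x.2 + 1))
      (Sum.elim (fun _ _ => μ) fun k x => w * ((occ x.1 k : ℝ) + occ x.1 (finRotate L k)))
      fun x => exitRate w μ x.1 := by
  refine LinearMap.ext fun f => funext fun x => ?_
  simp only [hopping_apply, Fintype.sum_sum_type, Sum.elim_inl, Sum.elim_inr, exitRate,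
    Finset.sum_mul, ← Finset.sum_add_distrib, ← Finset.sum_sub_distrib]
  rfl

lemma jointGenerator_pow_weighted (n : ℕ) (f : Config L → ℝ) :
    (jointGenerator L w μ ^ n) (fun x => f x.1 * a ^ x.2) =
      fun x => (tiltedGenerator L w μ a ^ n) f x.1 * a ^ x.2 := by
  induction n with
  | zero => rfl
  | succ n ih =>
    simp only [pow_succ', Module.End.mul_apply, ih]
    funext x
    simp only [jointGenerator_eq_hopping, tiltedGenerator, hopping_apply, Fintype.sum_sum_type,
      Sum.elim_inl, Sum.elim_inr, sub_mul, Finset.sum_mul, ← Finset.sum_add_distrib]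
    congr 1
    · exact Finset.sum_congr rfl fun k _ => by ring
    · ring

lemma occ_le_one (η : Config L) (k : Fin L) : occ η k ≤ 1 := by
  unfold occ; split_ifs <;> simp

lemma sum_abs_occ_pair_le (η : Config L) :
    ∑ k, |(occ η k : ℝ) + occ η (finRotate L k)| ≤ L * 2 := by
  have h : ∀ k, |(occ η k : ℝ) + occ η (finRotate L k)| ≤ 2 := fun k => by
    rw [abs_of_nonneg (by positivity)]
    exact_mod_cast add_le_add (occ_le_one η k) (occ_le_one η (finRotate L k))
  simpa using Finset.sum_le_sum fun k (_ : k ∈ Finset.univ) => h k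

lemma sum_abs_jump_rates_le (w : ℝ) (η : Config L) :
    ∑ k, |w * ((occ η k : ℝ) + occ η (finRotate L k))| ≤ |w| * (L * 2) := by
  simp only [abs_mul, ← Finset.mul_sum]
  gcongr
  exact sum_abs_occ_pair_le η

/-- The activity only enters the generator through the powers `a ^ A`, so the joint process
weighted by `a ^ A` evolves by the tilted generator on configurations. -/
theorem activityMGF_eq_expAction (ha₀ : 0 ≤ a) (ha₁ : a ≤ 1) {s : EReal}
    (hs : EReal.exp s = ENNReal.ofReal a) (η : Config L) (t : ℝ) :
    activityMGF L w μ η s t = expAction (tiltedGenerator L w μ a) t 1 η := by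
  have hweight (A : ℕ) : (EReal.exp (s * (A : EReal))).toReal = a ^ A := by
    rw [mul_comm, EReal.exp_nmul, hs, ENNReal.toReal_pow, ENNReal.toReal_ofReal ha₀]
  have hexit (η : Config L) : |exitRate w μ η| ≤ L * |μ| + |w| * (L * 2) := by
    rw [exitRate, Finset.sum_add_distrib]
    refine (abs_add_le _ _).trans (add_le_add (by simp [abs_mul]) ?_)
    exact (Finset.abs_sum_le_sum_abs _ _).trans (sum_abs_jump_rates_le w η)
  calc activityMGF L w μ η s t
      = ∑' y : JointState L, expAction (jointGenerator L w μ) t (Pi.single y 1) (η, 0)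
          * a ^ y.2 := tsum_congr fun y => by rw [hweight]; rfl
    _ = expAction (jointGenerator L w μ) t (fun y => a ^ y.2) (η, 0) := by
        rw [jointGenerator_eq_hopping]
        refine tsum_expAction_single_mul (B := 1)
          (C := L * |μ| + |w| * (L * 2) + (L * |μ| + |w| * (L * 2))) (fun x => ?_)
          (fun y => by rw [abs_of_nonneg (by positivity)]; exact pow_le_one₀ ha₀ ha₁) t (η, 0)
        simp only [Fintype.sum_sum_type, Sum.elim_inl, Sum.elim_inr]
        refine add_le_add (add_le_add (by simp) (sum_abs_jump_rates_le w x.1)) (hexit x.1)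
    _ = expAction (tiltedGenerator L w μ a) t 1 η := tsum_congr fun n => by
        have h := congrFun (jointGenerator_pow_weighted (w := w) (μ := μ) (a := a) n 1) (η, 0)
        simp only [Pi.one_apply, one_mul, pow_zero, mul_one] at h
        rw [h]

lemma exp_criticalPoint (w μ : ℝ) :
    EReal.exp (criticalPoint w μ) = ENNReal.ofReal (1 - μ / w) := by
  rw [criticalPoint, ENNReal.exp_log]

end ActivityMGF

section GrowthRate

variable {X κ : Type*} [Fintype κ]

lemma expAction_smul (H : Module.End ℝ (X → ℝ)) (t a : ℝ) (f : X → ℝ) (x : X) :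
    expAction H t (a • f) x = a * expAction H t f x := by
  simp only [expAction, map_smul, Pi.smul_apply, smul_eq_mul, ← tsum_mul_left, mul_left_comm]

lemma expAction_eigenvector {H : Module.End ℝ (X → ℝ)} {Λ : ℝ} {v : X → ℝ} (hv : H v = Λ • v)
    (t : ℝ) (x : X) : expAction H t v x = Real.exp (t * Λ) * v x := by
  have hpow (n : ℕ) : (H ^ n) v = Λ ^ n • v := by
    induction n with
    | zero => simp
    | succ n ih => rw [pow_succ', Module.End.mul_apply, ih, map_smul, hv, smul_smul, pow_succ]
  have hexp := (NormedSpace.expSeries_div_hasSum_exp (t * Λ)).mul_right (v x)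
  rw [← Real.exp_eq_exp_ℝ] at hexp
  rw [← hexp.tsum_eq]
  refine tsum_congr fun n => ?_
  rw [hpow, Pi.smul_apply, smul_eq_mul, mul_pow]
  ring

lemma hopping_pow_nonneg_on {F : κ → X → X} {r : κ → X → ℝ} {D f : X → ℝ} {S : Set X}
    (hF : ∀ k, Set.MapsTo (F k) S S) (hr : ∀ k, ∀ x ∈ S, 0 ≤ r k x) (hD : ∀ x ∈ S, D x ≤ 0)
    (hf : ∀ x ∈ S, 0 ≤ f x) (n : ℕ) : ∀ x ∈ S, 0 ≤ (hopping F r D ^ n) f x := by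
  induction n with
  | zero => exact hf
  | succ n ih =>
    intro x hx
    rw [pow_succ', Module.End.mul_apply, hopping_apply, sub_nonneg]
    exact (mul_nonpos_of_nonpos_of_nonneg (hD x hx) (ih x hx)).trans
      (Finset.sum_nonneg fun k _ => mul_nonneg (hr k x hx) (ih _ (hF k hx)))

lemma hasSum_expAction [Fintype X] (H : Module.End ℝ (X → ℝ)) (t : ℝ) (f : X → ℝ) (x : X) :
    HasSum (fun n : ℕ => t ^ n / (n.factorial : ℝ) * (H ^ n) f x)
      (NormedSpace.exp (t • Module.End.toContinuousLinearMap (X → ℝ) H) f x) := by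
  have h := (ContinuousLinearMap.proj (R := ℝ) (φ := fun _ : X => ℝ) x).hasSum
    ((ContinuousLinearMap.apply ℝ (X → ℝ) f).hasSum (NormedSpace.exp_series_hasSum_exp' (𝕂 := ℝ)
      (t • Module.End.toContinuousLinearMap (X → ℝ) H)))
  convert h using 2 with n
  · rw [smul_pow, ← map_pow, div_eq_inv_mul, mul_assoc]
    rfl
  · rfl

variable [Finite X]

lemma expAction_add_smul_one (H : Module.End ℝ (X → ℝ)) (c t : ℝ) (f : X → ℝ) (x : X) :
    expAction (H + c • 1) t f x = Real.exp (t * c) * expAction H t f x := by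
  cases nonempty_fintype X
  let _ : NormedAlgebra ℚ ((X → ℝ) →L[ℝ] (X → ℝ)) := NormedAlgebra.restrictScalars ℚ ℝ _
  have hsplit : t • Module.End.toContinuousLinearMap (X → ℝ) (H + c • 1) =
      algebraMap ℝ _ (t * c) + t • Module.End.toContinuousLinearMap (X → ℝ) H := by
    rw [map_add, map_smul, map_one, Algebra.algebraMap_eq_smul_one]
    module
  rw [expAction, expAction, (hasSum_expAction _ t f x).tsum_eq, (hasSum_expAction H t f x).tsum_eq,
    hsplit, NormedSpace.exp_add_of_commute (Algebra.commutes _ _),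
    ← NormedSpace.algebraMap_exp_comm, ← Real.exp_eq_exp_ℝ, Algebra.algebraMap_eq_smul_one,
    smul_mul_assoc, one_mul]
  rfl

lemma expAction_mono_on {F : κ → X → X} {r : κ → X → ℝ} {S : Set X}
    (hF : ∀ k, Set.MapsTo (F k) S S) (hr : ∀ k, ∀ x ∈ S, 0 ≤ r k x) (D : X → ℝ) {f g : X → ℝ}
    (hfg : ∀ x ∈ S, f x ≤ g x) {t : ℝ} (ht : 0 ≤ t) {x : X} (hx : x ∈ S) :
    expAction (hopping F r D) t f x ≤ expAction (hopping F r D) t g x := by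
  cases nonempty_fintype X
  obtain ⟨c, hc⟩ := (Set.finite_range D).bddAbove
  set H := hopping F r fun x => D x - c
  have hH : hopping F r D = H + (-c) • 1 := by
    refine LinearMap.ext fun f => funext fun x => ?_
    simp only [H, LinearMap.add_apply, LinearMap.smul_apply, Module.End.one_apply, Pi.add_apply,
      Pi.smul_apply, smul_eq_mul, hopping_apply]
    ring
  rw [hH, expAction_add_smul_one, expAction_add_smul_one]
  refine mul_le_mul_of_nonneg_left ?_ (Real.exp_pos _).le
  refine (hasSum_expAction H t f x).summable.tsum_le_tsum (fun n => ?_)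
    (hasSum_expAction H t g x).summable
  have hpow := hopping_pow_nonneg_on (D := fun x => D x - c) (f := g - f) hF hr
    (fun x _ => sub_nonpos.2 (hc (Set.mem_range_self x)))
    (fun x hx => sub_nonneg.2 (hfg x hx)) n x hx
  rw [map_sub, Pi.sub_apply, sub_nonneg] at hpow
  exact mul_le_mul_of_nonneg_left hpow (by positivity)

lemma exists_pos_mul_le_on {S : Set X} {f g : X → ℝ} (hg : ∀ x ∈ S, 0 < g x) :
    ∃ a > 0, ∀ x ∈ S, a * f x ≤ g x := by
  have h : ∀ᶠ a : ℝ in 𝓝[>] 0, ∀ x, x ∈ S → a * f x ≤ g x := by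
    refine eventually_all.2 fun x => ?_
    by_cases hx : x ∈ S
    · have hlim : Tendsto (fun a : ℝ => a * f x) (𝓝[>] 0) (𝓝 0) := by
        simpa using (tendsto_id.mul_const (f x)).mono_left (nhdsWithin_le_nhds (a := (0 : ℝ)))
      exact (hlim.eventually_lt_const (hg x hx)).mono fun a ha _ => ha.le
    · exact .of_forall fun a hx' => absurd hx' hx
  obtain ⟨a, ha, ha₀⟩ := (h.and self_mem_nhdsWithin).exists
  exact ⟨a, ha₀, ha⟩

lemma tendsto_log_mul_exp_div {b : ℝ} (hb : 0 < b) (Λ : ℝ) :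
    Tendsto (fun t : ℝ => Real.log (b * Real.exp (t * Λ)) / t) atTop (𝓝 Λ) := by
  have hlim : Tendsto (fun t : ℝ => Real.log b / t + Λ) atTop (𝓝 Λ) := by
    simpa using (tendsto_const_nhds.div_atTop tendsto_id).add_const Λ
  refine hlim.congr' ((eventually_gt_atTop 0).mono fun t ht => ?_)
  dsimp only
  rw [Real.log_mul hb.ne' (Real.exp_pos _).ne', Real.log_exp]
  field_simp

/-- On an invariant set, a positive initial function is squeezed between two multiples of a
positive eigenvector. -/
theorem tendsto_log_expAction_div {F : κ → X → X} {r : κ → X → ℝ} {D f v : X → ℝ} {S : Set X}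
    {Λ : ℝ} (hF : ∀ k, Set.MapsTo (F k) S S) (hr : ∀ k, ∀ x ∈ S, 0 ≤ r k x)
    (hv : hopping F r D v = Λ • v) (hv₀ : ∀ x ∈ S, 0 < v x) (hf₀ : ∀ x ∈ S, 0 < f x) {x : X}
    (hx : x ∈ S) :
    Tendsto (fun t : ℝ => Real.log (expAction (hopping F r D) t f x) / t) atTop (𝓝 Λ) := by
  obtain ⟨a, ha, hav⟩ := exists_pos_mul_le_on (f := v) hf₀
  obtain ⟨b, hb, hbf⟩ := exists_pos_mul_le_on (f := f) hv₀
  have hvx := hv₀ x hx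
  have hlower {t : ℝ} (ht : 0 < t) :
      a * v x * Real.exp (t * Λ) ≤ expAction (hopping F r D) t f x := by
    have h := expAction_mono_on hF hr D (f := a • v) hav ht.le hx
    rw [expAction_smul, expAction_eigenvector hv] at h
    linarith
  have hupper {t : ℝ} (ht : 0 < t) :
      expAction (hopping F r D) t f x ≤ v x / b * Real.exp (t * Λ) := by
    have h := expAction_mono_on hF hr D (f := b • f) hbf ht.le hx
    rw [expAction_smul, expAction_eigenvector hv] at h
    rw [div_mul_eq_mul_div, le_div_iff₀ hb]
    linarith
  refine tendsto_of_tendsto_of_tendsto_of_le_of_le'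
    (tendsto_log_mul_exp_div (mul_pos ha hvx) Λ) (tendsto_log_mul_exp_div (div_pos hvx hb) Λ)
    ((eventually_gt_atTop 0).mono fun t ht => ?_) ((eventually_gt_atTop 0).mono fun t ht => ?_)
  · have := hlower ht
    gcongr
  · have := (mul_pos (mul_pos ha hvx) (Real.exp_pos _)).trans_le (hlower ht)
    have := hupper ht
    gcongr

end GrowthRate

section PerronFrobenius

variable {X κ : Type*} [Fintype X]

/-- `Λ` is the maximum of the Rayleigh quotient `⟨f, T f⟩ / ⟨f, f⟩` over the nonzero `f ∈ V`. -/
def IsMaxRayleigh (T : Module.End ℝ (X → ℝ)) (V : Submodule ℝ (X → ℝ)) (Λ : ℝ) : Prop :=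
  (∀ f ∈ V, f ⬝ᵥ T f ≤ Λ * (f ⬝ᵥ f)) ∧ ∃ φ ∈ V, φ ≠ 0 ∧ φ ⬝ᵥ T φ = Λ * (φ ⬝ᵥ φ)

lemma dotProduct_self_nonneg (f : X → ℝ) : 0 ≤ f ⬝ᵥ f :=
  Finset.sum_nonneg fun x _ => mul_self_nonneg (f x)

lemma dotProduct_self_pos {f : X → ℝ} (hf : f ≠ 0) : 0 < f ⬝ᵥ f :=
  (dotProduct_self_nonneg f).lt_of_ne' (dotProduct_self_eq_zero.not.2 hf)

lemma isCompact_dotProduct_self_eq_one_inter (V : Submodule ℝ (X → ℝ)) :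
    IsCompact {f | f ⬝ᵥ f = 1 ∧ f ∈ V} := by
  have hclosed : IsClosed {f | f ⬝ᵥ f = 1 ∧ f ∈ V} :=
    (isClosed_eq (continuous_id.dotProduct continuous_id) continuous_const).inter
      V.closed_of_finiteDimensional
  refine (isCompact_univ_pi fun _ : X => isCompact_Icc (a := (-1 : ℝ)) (b := 1)).of_isClosed_subset
    hclosed fun f hf x _ => ?_
  rw [Set.mem_Icc, ← abs_le, ← sq_le_one_iff_abs_le_one, sq, ← hf.1]
  exact Finset.single_le_sum (f := fun x => f x * f x) (fun y _ => mul_self_nonneg (f y))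
    (Finset.mem_univ x)

lemma exists_isMaxRayleigh (T : Module.End ℝ (X → ℝ)) {V : Submodule ℝ (X → ℝ)} (hV : V ≠ ⊥) :
    ∃ Λ, IsMaxRayleigh T V Λ := by
  have hquad : Continuous fun f => f ⬝ᵥ T f :=
    continuous_id.dotProduct T.continuous_of_finiteDimensional
  have hmem {f : X → ℝ} (hfV : f ∈ V) (hf : f ≠ 0) :
      (√(f ⬝ᵥ f))⁻¹ • f ∈ {f | f ⬝ᵥ f = 1 ∧ f ∈ V} := by
    have hpos := dotProduct_self_pos hf
    refine ⟨?_, V.smul_mem _ hfV⟩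
    rw [smul_dotProduct, dotProduct_smul, smul_smul, ← mul_inv, Real.mul_self_sqrt hpos.le,
      smul_eq_mul, inv_mul_cancel₀ hpos.ne']
  obtain ⟨g, hgV, hg⟩ := V.ne_bot_iff.1 hV
  obtain ⟨φ, ⟨hφ, hφV⟩, hmax⟩ := (isCompact_dotProduct_self_eq_one_inter V).exists_isMaxOn
    ⟨_, hmem hgV hg⟩ hquad.continuousOn
  refine ⟨φ ⬝ᵥ T φ, fun f hfV => ?_, φ, hφV, fun h => by simp [h] at hφ, by rw [hφ, mul_one]⟩
  rcases eq_or_ne f 0 with rfl | hf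
  · simp
  · have hpos := dotProduct_self_pos hf
    have h : (√(f ⬝ᵥ f))⁻¹ • f ⬝ᵥ T ((√(f ⬝ᵥ f))⁻¹ • f) ≤ φ ⬝ᵥ T φ := hmax (hmem hfV hf)
    rwa [map_smul, smul_dotProduct, dotProduct_smul, smul_smul, ← mul_inv,
      Real.mul_self_sqrt hpos.le, smul_eq_mul, inv_mul_le_iff₀ hpos, mul_comm] at h

lemma IsMaxRayleigh.apply_eq_smul {T : Module.End ℝ (X → ℝ)} {V : Submodule ℝ (X → ℝ)} {Λ : ℝ}
    (hΛ : IsMaxRayleigh T V Λ) (hT : ∀ f g, f ⬝ᵥ T g = g ⬝ᵥ T f) (hTV : ∀ f ∈ V, T f ∈ V)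
    {φ : X → ℝ} (hφV : φ ∈ V) (hφ : φ ⬝ᵥ T φ = Λ * (φ ⬝ᵥ φ)) : T φ = Λ • φ := by
  set h := T φ - Λ • φ with h_def
  have hTφ : T φ = h + Λ • φ := by rw [h_def, sub_add_cancel]
  have hvariation : ∀ t : ℝ,
      0 ≤ (Λ * (h ⬝ᵥ h) - h ⬝ᵥ T h) * (t * t) + (-2 * (h ⬝ᵥ h)) * t + 0 := fun t => by
    have hf := hΛ.1 (φ + t • h)
      (V.add_mem hφV (V.smul_mem t (V.sub_mem (hTV φ hφV) (V.smul_mem Λ hφV))))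
    simp only [map_add, map_smul, add_dotProduct, dotProduct_add, smul_dotProduct,
      dotProduct_smul, smul_eq_mul, hφ, hT φ h] at hf
    simp only [hTφ, dotProduct_add, dotProduct_smul, smul_eq_mul, dotProduct_comm φ h] at hf
    linarith
  have hdiscrim := discrim_le_zero hvariation
  rw [discrim] at hdiscrim
  have hzero : h ⬝ᵥ h = 0 := by nlinarith
  rw [hTφ, dotProduct_self_eq_zero.1 hzero, zero_add]

/-- The functions that vanish outside `S`; for `S` a set of configurations of fixed parity this
is a symmetry sector. -/
def supportedOn (S : Set X) : Submodule ℝ (X → ℝ) := Submodule.pi Sᶜ fun _ => ⊥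

omit [Fintype X] in
lemma mem_supportedOn {S : Set X} {f : X → ℝ} : f ∈ supportedOn S ↔ ∀ x ∉ S, f x = 0 := by
  simp [supportedOn, Submodule.mem_pi]

omit [Fintype X] in
lemma abs_mem_supportedOn {S : Set X} {f : X → ℝ} (hf : f ∈ supportedOn S) :
    |f| ∈ supportedOn S :=
  mem_supportedOn.2 fun x hx => by rw [Pi.abs_apply, mem_supportedOn.1 hf x hx, abs_zero]

omit [Fintype X] in
lemma supportedOn_ne_bot {S : Set X} (hS : S.Nonempty) : supportedOn S ≠ ⊥ := by
  classical
  obtain ⟨x₀, hx₀⟩ := hS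
  exact (Submodule.ne_bot_iff _).2 ⟨Pi.single x₀ 1, mem_supportedOn.2 fun x hx =>
    Pi.single_eq_of_ne (ne_of_mem_of_not_mem hx₀ hx).symm _, by simp⟩

variable [Fintype κ]

omit [Fintype X] in
lemma hopping_mem_supportedOn {F : κ → X → X} (hF : ∀ k, Function.Involutive (F k))
    (r : κ → X → ℝ) (D : X → ℝ) {S : Set X} (hFS : ∀ k, Set.MapsTo (F k) S S) {f : X → ℝ}
    (hf : f ∈ supportedOn S) : hopping F r D f ∈ supportedOn S := by
  rw [mem_supportedOn] at hf ⊢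
  have hFS' (k : κ) {x : X} (hx : x ∉ S) : F k x ∉ S := fun h => hx (hF k x ▸ hFS k h)
  intro x hx
  simp [hopping_apply, hf x hx, hf _ (hFS' _ hx)]

omit [Fintype X] in
lemma mapsTo_zeros_of_hopping_eq_smul {F : κ → X → X} {r : κ → X → ℝ} (hr₀ : ∀ k x, 0 < r k x)
    {D φ : X → ℝ} {Λ : ℝ} (hφ : ∀ x, 0 ≤ φ x) (heig : hopping F r D φ = Λ • φ) (k : κ) :
    Set.MapsTo (F k) {x | φ x = 0} {x | φ x = 0} := by
  intro x (hx : φ x = 0)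
  have hsum := congrFun heig x
  rw [hopping_apply, Pi.smul_apply, hx, mul_zero, sub_zero, smul_zero] at hsum
  have hterm := (Finset.sum_eq_zero_iff_of_nonneg fun k _ =>
    mul_nonneg (hr₀ k x).le (hφ (F k x))).1 hsum k (Finset.mem_univ k)
  exact (mul_eq_zero.1 hterm).resolve_left (hr₀ k x).ne'

lemma dotProduct_hopping_comm {F : κ → X → X} (hF : ∀ k, Function.Involutive (F k))
    {r : κ → X → ℝ} (hr : ∀ k x, r k (F k x) = r k x) (D f g : X → ℝ) :
    f ⬝ᵥ hopping F r D g = g ⬝ᵥ hopping F r D f := by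
  simp only [dotProduct, hopping_apply, mul_sub, Finset.sum_sub_distrib, Finset.mul_sum]
  congr 1
  · rw [Finset.sum_comm, Finset.sum_comm (s := Finset.univ (α := X))]
    refine Finset.sum_congr rfl fun k _ => ?_
    rw [← Equiv.sum_comp (hF k).toPerm]
    refine Finset.sum_congr rfl fun x _ => ?_
    simp only [Function.Involutive.coe_toPerm, hF k x, hr]
    ring
  · exact Finset.sum_congr rfl fun x _ => by ring

/-- Diamagnetic inequality: signs in the hopping amplitudes only decrease the quadratic form. -/
lemma dotProduct_hopping_le_abs (F : κ → X → X) {r r' : κ → X → ℝ}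
    (hr : ∀ k x, |r' k x| ≤ r k x) (D f : X → ℝ) :
    f ⬝ᵥ hopping F r' D f ≤ |f| ⬝ᵥ hopping F r D |f| := by
  simp only [dotProduct, hopping_apply, mul_sub, Pi.abs_apply, Finset.mul_sum]
  refine Finset.sum_le_sum fun x _ => sub_le_sub (Finset.sum_le_sum fun k _ => ?_) ?_
  · refine (le_abs_self _).trans ?_
    rw [abs_mul, abs_mul]
    gcongr
    exact hr k x
  · rw [mul_left_comm, mul_left_comm (f x), abs_mul_abs_self]

omit [Fintype κ] in
lemma dotProduct_abs_self (f : X → ℝ) : |f| ⬝ᵥ |f| = f ⬝ᵥ f :=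
  Finset.sum_congr rfl fun x _ => abs_mul_abs_self (f x)

/-- **Perron–Frobenius** for a symmetric hopping operator on an invariant set `S` whose points are
all connected by the moves `F k`. By the diamagnetic inequality the maximizer may be taken
nonnegative, and the zero set of a nonnegative eigenvector is closed under the moves. -/
theorem exists_pos_eigenvector_isMaxRayleigh {F : κ → X → X}
    (hF : ∀ k, Function.Involutive (F k)) {r : κ → X → ℝ} (hr : ∀ k x, r k (F k x) = r k x)
    (hr₀ : ∀ k x, 0 < r k x) (D : X → ℝ) {S : Set X} (hS : S.Nonempty)
    (hFS : ∀ k, Set.MapsTo (F k) S S)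
    (hirr : ∀ Z : Set X, (∀ k, Set.MapsTo (F k) Z Z) → (Z ∩ S).Nonempty → S ⊆ Z) :
    ∃ (Λ : ℝ) (φ : X → ℝ), IsMaxRayleigh (hopping F r D) (supportedOn S) Λ ∧
      φ ∈ supportedOn S ∧ (∀ x ∈ S, 0 < φ x) ∧ hopping F r D φ = Λ • φ := by
  obtain ⟨Λ, hΛ⟩ := exists_isMaxRayleigh (hopping F r D) (supportedOn_ne_bot hS)
  obtain ⟨ψ, hψS, hψ₀, hψ⟩ := hΛ.2
  have hφS := abs_mem_supportedOn hψS
  have hφ : |ψ| ⬝ᵥ hopping F r D |ψ| = Λ * (|ψ| ⬝ᵥ |ψ|) := by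
    refine (hΛ.1 _ hφS).antisymm ?_
    rw [dotProduct_abs_self, ← hψ]
    exact dotProduct_hopping_le_abs F (fun k x => (abs_of_pos (hr₀ k x)).le) D ψ
  have heig := hΛ.apply_eq_smul (dotProduct_hopping_comm hF hr D)
    (fun _ => hopping_mem_supportedOn hF r D hFS) hφS hφ
  refine ⟨Λ, |ψ|, hΛ, hφS, fun x hx => (abs_nonneg (ψ x)).lt_of_ne' fun hx₀ => hψ₀ ?_, heig⟩
  have hzeros : S ⊆ {y | |ψ| y = 0} := hirr _
    (mapsTo_zeros_of_hopping_eq_smul hr₀ (fun y => abs_nonneg (ψ y)) heig) ⟨x, hx₀, hx⟩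
  funext y
  by_cases hy : y ∈ S
  · exact abs_eq_zero.1 (hzeros hy)
  · exact mem_supportedOn.1 hψS y hy

end PerronFrobenius

section Majorana

variable {X ι : Type*}

lemma exists_common_kernel_vector {b : ι → Module.End ℝ (X → ℝ)} {P : Module.End ℝ (X → ℝ)}
    (hb : ∀ i j, b i * b j + b j * b i = 0) (hP : ∀ i, P * b i = -(b i * P)) {v : X → ℝ} {σ : ℝ}
    (hv : v ≠ 0) (hσ : |σ| = 1) (hPv : P v = σ • v) (s : Finset ι) :
    ∃ (Ω : X → ℝ) (τ : ℝ), Ω ≠ 0 ∧ |τ| = 1 ∧ P Ω = τ • Ω ∧ ∀ i ∈ s, b i Ω = 0 := by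
  classical
  induction s using Finset.induction_on with
  | empty => exact ⟨v, σ, hv, hσ, hPv, by simp⟩
  | insert i s _ ih =>
    obtain ⟨Ω, τ, hΩ, hτ, hPΩ, hker⟩ := ih
    by_cases hi : b i Ω = 0
    · exact ⟨Ω, τ, hΩ, hτ, hPΩ, Finset.forall_mem_insert _ _ _ |>.2 ⟨hi, hker⟩⟩
    · refine ⟨b i Ω, -τ, hi, by rwa [abs_neg], ?_, fun j hj => ?_⟩
      · have h := LinearMap.congr_fun (hP i) Ω
        rwa [Module.End.mul_apply, LinearMap.neg_apply, Module.End.mul_apply, hPΩ, map_smul,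
          ← neg_smul] at h
      · have h := LinearMap.congr_fun (hb j i) Ω
        rw [LinearMap.add_apply, Module.End.mul_apply, Module.End.mul_apply] at h
        rcases Finset.mem_insert.1 hj with rfl | hj
        · exact self_eq_neg.1 (eq_neg_of_add_eq_zero_left h)
        · rwa [hker j hj, map_zero, add_zero] at h

variable [Fintype ι]

/-- The linear combination `∑ i, c i • A i` of the operators `A i`. -/
def mode (A : ι → Module.End ℝ (X → ℝ)) : (ι → ℝ) →ₗ[ℝ] Module.End ℝ (X → ℝ) :=
  Fintype.linearCombination ℝ A

lemma mode_apply (A : ι → Module.End ℝ (X → ℝ)) (c : ι → ℝ) : mode A c = ∑ i, c i • A i :=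
  Fintype.linearCombination_apply ℝ A c

lemma mode_mul_eq_neg {A : ι → Module.End ℝ (X → ℝ)} {Q : Module.End ℝ (X → ℝ)}
    (hQ : ∀ i, Q * A i = -(A i * Q)) (c : ι → ℝ) : Q * mode A c = -(mode A c * Q) := by
  simp only [mode_apply, Finset.mul_sum, Finset.sum_mul, mul_smul_comm, smul_mul_assoc, hQ,
    smul_neg, Finset.sum_neg_distrib]

lemma mode_vecMul {κ : Type*} [Fintype κ] (A : ι → Module.End ℝ (X → ℝ)) (M : Matrix κ ι ℝ)
    (c : κ → ℝ) : mode A (Matrix.vecMul c M) = ∑ j, c j • mode A (M j) := by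
  simp only [Matrix.vecMul_eq_sum, map_sum, map_smul]

/-- The quadratic operator `∑ j l, M j l • (B j * A l)`, as a linear function of `M`. -/
def majoranaForm (A B : ι → Module.End ℝ (X → ℝ)) :
    Matrix ι ι ℝ →ₗ[ℝ] Module.End ℝ (X → ℝ) where
  toFun M := ∑ j, B j * mode A (M j)
  map_add' M N := by
    rw [← Finset.sum_add_distrib]
    exact Finset.sum_congr rfl fun j _ => by rw [← mul_add, ← map_add]; rfl
  map_smul' c M := by
    rw [RingHom.id_apply, Finset.smul_sum]
    exact Finset.sum_congr rfl fun j _ => by rw [← mul_smul_comm, ← map_smul]; rfl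

lemma majoranaForm_apply (A B : ι → Module.End ℝ (X → ℝ)) (M : Matrix ι ι ℝ) :
    majoranaForm A B M = ∑ j, B j * mode A (M j) := rfl

lemma majoranaForm_apply_apply (A B : ι → Module.End ℝ (X → ℝ)) (M : Matrix ι ι ℝ) (f : X → ℝ)
    (x : X) : majoranaForm A B M f x = ∑ j, ∑ l, M j l * B j (A l f) x := by
  simp [majoranaForm_apply, mode_apply, LinearMap.sum_apply, Finset.mul_sum]

lemma majoranaForm_mul (A B : ι → Module.End ℝ (X → ℝ)) (W R : Matrix ι ι ℝ) :
    majoranaForm A B (W * R) = ∑ i, mode B (W.transpose i) * mode A (R i) := by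
  simp only [majoranaForm_apply, Matrix.mul_apply_eq_vecMul, mode_vecMul, Finset.mul_sum]
  rw [Finset.sum_comm]
  simp only [mode_apply B, Finset.sum_mul, mul_smul_comm, smul_mul_assoc, Matrix.transpose_apply]

variable [DecidableEq ι]

lemma mode_mul_mode_add {A : ι → Module.End ℝ (X → ℝ)} {e : ℝ}
    (hA : ∀ i j, A i * A j + A j * A i = (if i = j then e else 0) • 1) (c d : ι → ℝ) :
    mode A c * mode A d + mode A d * mode A c = (e * (c ⬝ᵥ d)) • 1 := by
  have hexpand : mode A c * mode A d + mode A d * mode A c =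
      ∑ i, ∑ j, (c i * d j) • (A i * A j + A j * A i) := by
    simp only [mode_apply, Finset.sum_mul_sum, smul_mul_smul_comm, smul_add,
      Finset.sum_add_distrib]
    congr 1
    rw [Finset.sum_comm]
    simp only [mul_comm]
  simp [hexpand, hA, dotProduct, smul_smul, ← Finset.sum_smul, Finset.mul_sum, mul_comm]

variable [Fintype X]

omit [DecidableEq ι] in
lemma mode_dotProduct {A : ι → Module.End ℝ (X → ℝ)} {e : ℝ}
    (hA : ∀ i f g, A i f ⬝ᵥ g = e * (f ⬝ᵥ A i g)) (c : ι → ℝ) (f g : X → ℝ) :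
    mode A c f ⬝ᵥ g = e * (f ⬝ᵥ mode A c g) := by
  simp only [mode_apply, LinearMap.sum_apply, LinearMap.smul_apply, sum_dotProduct, dotProduct_sum,
    smul_dotProduct, dotProduct_smul, hA, Finset.mul_sum, smul_eq_mul, mul_left_comm]

/-- Real Majorana operators `A i` and `i B i`: since `B i` is a real matrix, it is antisymmetric
with square `-1` instead of symmetric with square `1`. -/
structure IsMajorana (A B : ι → Module.End ℝ (X → ℝ)) : Prop where
  mul_add_mul_left : ∀ i j, A i * A j + A j * A i = (if i = j then (2 : ℝ) else 0) • 1
  mul_add_mul_right : ∀ i j, B i * B j + B j * B i = (if i = j then (-2 : ℝ) else 0) • 1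
  mul_eq_neg : ∀ i j, B j * A i = -(A i * B j)
  symm_left : ∀ i f g, A i f ⬝ᵥ g = f ⬝ᵥ A i g
  antisymm_right : ∀ i f g, B i f ⬝ᵥ g = -(f ⬝ᵥ B i g)

/-- `T` is the trace norm of `M`, certified by a polar decomposition: `U` is orthogonal with
`tr (M Uᵀ) = T`, and a factorization of `M` gives the matching upper bound. -/
def IsTraceNorm (M : Matrix ι ι ℝ) (T : ℝ) : Prop :=
  ∃ U W R : Matrix ι ι ℝ, U * U.transpose = 1 ∧ (M * U.transpose).trace = T ∧
    W * R = M ∧ ((W * W.transpose).trace + (R * R.transpose).trace) / 2 = T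

namespace IsMajorana

variable {A B : ι → Module.End ℝ (X → ℝ)} (h : IsMajorana A B)

include h

lemma mode_left_dotProduct (c : ι → ℝ) (f g : X → ℝ) : mode A c f ⬝ᵥ g = f ⬝ᵥ mode A c g := by
  simpa using mode_dotProduct (e := 1) (fun i f g => by rw [h.symm_left, one_mul]) c f g

lemma mode_right_dotProduct (c : ι → ℝ) (f g : X → ℝ) :
    mode B c f ⬝ᵥ g = -(f ⬝ᵥ mode B c g) := by
  simpa using mode_dotProduct (e := -1) (fun i f g => by rw [h.antisymm_right, neg_one_mul]) c f g

lemma mode_left_dotProduct_mode_left (c d : ι → ℝ) (f : X → ℝ) :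
    mode A c f ⬝ᵥ mode A d f = (c ⬝ᵥ d) * (f ⬝ᵥ f) := by
  have hcd := congrArg (fun T : Module.End ℝ (X → ℝ) => f ⬝ᵥ T f)
    (mode_mul_mode_add h.mul_add_mul_left c d)
  simp only [LinearMap.add_apply, Module.End.mul_apply, dotProduct_add, LinearMap.smul_apply,
    Module.End.one_apply, dotProduct_smul, smul_eq_mul, ← h.mode_left_dotProduct c f,
    ← h.mode_left_dotProduct d f, dotProduct_comm (mode A d f)] at hcd
  linarith

lemma mode_right_mode_right (c : ι → ℝ) (f : X → ℝ) :
    mode B c (mode B c f) = -(c ⬝ᵥ c) • f := by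
  have hc := LinearMap.congr_fun (mode_mul_mode_add h.mul_add_mul_right c c) f
  simp only [LinearMap.add_apply, Module.End.mul_apply, LinearMap.smul_apply,
    Module.End.one_apply, ← two_smul ℝ (mode B c _)] at hc
  refine smul_right_injective _ (two_ne_zero (α := ℝ)) (hc.trans ?_)
  module

lemma mode_right_dotProduct_self (c : ι → ℝ) (f : X → ℝ) :
    mode B c f ⬝ᵥ mode B c f = (c ⬝ᵥ c) * (f ⬝ᵥ f) := by
  rw [h.mode_right_dotProduct, h.mode_right_mode_right, neg_smul, dotProduct_neg, neg_neg,
    dotProduct_smul, smul_eq_mul]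

lemma dotProduct_mode_mul_mode_le (c d : ι → ℝ) (f : X → ℝ) :
    f ⬝ᵥ (mode B c * mode A d) f ≤ (c ⬝ᵥ c + d ⬝ᵥ d) / 2 * (f ⬝ᵥ f) := by
  have hnonneg := dotProduct_self_nonneg (mode B c f + mode A d f)
  simp only [add_dotProduct, dotProduct_add, dotProduct_comm (mode A d f) (mode B c f),
    h.mode_right_dotProduct_self, h.mode_left_dotProduct_mode_left] at hnonneg
  have hflip := h.mode_right_dotProduct c f (mode A d f)
  rw [Module.End.mul_apply]
  linarith

variable {M : Matrix ι ι ℝ} {T : ℝ}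

/-- The form of a factorized matrix is a sum of products of two modes, to each of which the
inequality of arithmetic and geometric means applies. -/
lemma dotProduct_form_le (hT : IsTraceNorm M T) (f : X → ℝ) :
    f ⬝ᵥ majoranaForm A B M f ≤ T * (f ⬝ᵥ f) := by
  obtain ⟨-, W, R, -, -, rfl, rfl⟩ := hT
  rw [majoranaForm_mul, LinearMap.sum_apply, dotProduct_sum]
  refine (Finset.sum_le_sum fun i _ => h.dotProduct_mode_mul_mode_le _ _ f).trans_eq ?_
  rw [Matrix.trace_mul_comm W, ← Finset.sum_mul, ← Finset.sum_div, Finset.sum_add_distrib]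
  rfl

/-- The bound by the trace norm is attained at a joint kernel vector of the anticommuting nilpotent
operators `mode A (U i) + B i`, where `U` is the orthogonal part of `M`. -/
lemma exists_dotProduct_form_eq (hT : IsTraceNorm M T) {P : Module.End ℝ (X → ℝ)}
    (hPA : ∀ i, P * A i = -(A i * P)) (hPB : ∀ i, P * B i = -(B i * P)) {v : X → ℝ} {σ : ℝ}
    (hv : v ≠ 0) (hσ : |σ| = 1) (hPv : P v = σ • v) :
    ∃ (Ω : X → ℝ) (τ : ℝ), Ω ≠ 0 ∧ |τ| = 1 ∧ P Ω = τ • Ω ∧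
      Ω ⬝ᵥ majoranaForm A B M Ω = T * (Ω ⬝ᵥ Ω) := by
  obtain ⟨U, -, -, hU, rfl, -, -⟩ := hT
  have hUU : ∀ i j, U i ⬝ᵥ U j = if i = j then 1 else 0 := fun i j => by
    rw [← Matrix.one_apply, ← hU]
    rfl
  have hnilpotent (i j : ι) : (mode A (U i) + B i) * (mode A (U j) + B j) +
      (mode A (U j) + B j) * (mode A (U i) + B i) = 0 := by
    calc _ = (mode A (U i) * mode A (U j) + mode A (U j) * mode A (U i)) +
          (B i * B j + B j * B i) + (mode A (U i) * B j + B j * mode A (U i)) +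
          (mode A (U j) * B i + B i * mode A (U j)) := by noncomm_ring
      _ = 0 := by
        rw [mode_mul_mode_add h.mul_add_mul_left, h.mul_add_mul_right, hUU,
          mode_mul_eq_neg fun l => h.mul_eq_neg l j, mode_mul_eq_neg fun l => h.mul_eq_neg l i,
          add_neg_cancel, add_neg_cancel, add_zero, add_zero, ← add_smul]
        split_ifs <;> simp
  obtain ⟨Ω, τ, hΩ, hτ, hPΩ, hker⟩ := exists_common_kernel_vector hnilpotent (P := P)
    (fun i => by rw [mul_add, add_mul, mode_mul_eq_neg hPA, hPB, neg_add]) hv hσ hPv Finset.univ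
  refine ⟨Ω, τ, hΩ, hτ, hPΩ, ?_⟩
  have hB (i : ι) : B i Ω = -mode A (U i) Ω :=
    eq_neg_of_add_eq_zero_right (hker i (Finset.mem_univ i))
  have hterm (j : ι) : Ω ⬝ᵥ (B j * mode A (M j)) Ω = (M j ⬝ᵥ U j) * (Ω ⬝ᵥ Ω) := by
    rw [Module.End.mul_apply, ← neg_eq_iff_eq_neg.2 (h.antisymm_right j Ω _), hB, neg_dotProduct,
      neg_neg, h.mode_left_dotProduct_mode_left, dotProduct_comm]
  rw [majoranaForm_apply, LinearMap.sum_apply, dotProduct_sum,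
    Finset.sum_congr rfl fun j _ => hterm j, ← Finset.sum_mul]
  rfl

lemma mode_right_form_apply {w : ι → ℝ} (hw : Matrix.vecMul w M = 0) (f : X → ℝ) :
    mode B w (majoranaForm A B M f) = majoranaForm A B M (mode B w f) := by
  have hB (j : ι) (g : X → ℝ) : mode B w (B j g) = -B j (mode B w g) - (2 * w j) • g := by
    have hj := LinearMap.congr_fun (mode_mul_mode_add h.mul_add_mul_right w (Pi.single j 1)) g
    rw [dotProduct_single_one, mode, Fintype.linearCombination_apply_single, one_smul,
      LinearMap.add_apply, Module.End.mul_apply, Module.End.mul_apply] at hj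
    rw [mode, eq_sub_of_add_eq hj, LinearMap.smul_apply, Module.End.one_apply]
    module
  have hA (c : ι → ℝ) : mode B w (mode A c f) = -mode A c (mode B w f) := by
    have hcomm : mode B w * mode A c = -(mode A c * mode B w) := mode_mul_eq_neg (fun i => by
      rw [← neg_eq_iff_eq_neg,
        ← mode_mul_eq_neg fun j => neg_eq_iff_eq_neg.1 (h.mul_eq_neg i j).symm]) c
    exact LinearMap.congr_fun hcomm f
  have hzero : ∑ j, w j • mode A (M j) f = 0 := by
    have hmode := LinearMap.congr_fun (mode_vecMul A M w) f
    rw [hw, map_zero, LinearMap.sum_apply] at hmode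
    exact hmode.symm
  simp only [majoranaForm_apply, LinearMap.sum_apply, map_sum, Module.End.mul_apply, hB, hA,
    map_neg, neg_neg, mul_smul, Finset.sum_sub_distrib, ← Finset.smul_sum, hzero, smul_zero,
    sub_zero]

lemma dotProduct_form_mode_right {w : ι → ℝ} (hw : Matrix.vecMul w M = 0) {Ω : X → ℝ}
    (hΩ : Ω ⬝ᵥ majoranaForm A B M Ω = T * (Ω ⬝ᵥ Ω)) :
    mode B w Ω ⬝ᵥ majoranaForm A B M (mode B w Ω) = T * (mode B w Ω ⬝ᵥ mode B w Ω) := by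
  rw [← h.mode_right_form_apply hw, h.mode_right_dotProduct_self, h.mode_right_dotProduct,
    h.mode_right_mode_right, neg_smul, dotProduct_neg, neg_neg, dotProduct_smul, smul_eq_mul, hΩ,
    mul_left_comm]

lemma mode_right_ne_zero {w : ι → ℝ} (hw : w ≠ 0) {Ω : X → ℝ} (hΩ : Ω ≠ 0) : mode B w Ω ≠ 0 := by
  refine dotProduct_self_eq_zero.not.1 ?_
  rw [h.mode_right_dotProduct_self]
  exact (mul_pos (dotProduct_self_pos hw) (dotProduct_self_pos hΩ)).ne'

/-- Filling or emptying the zero mode changes the parity at no cost in the form. -/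
lemma exists_dotProduct_form_eq_of_zero_mode (hT : IsTraceNorm M T) {P : Module.End ℝ (X → ℝ)}
    (hPA : ∀ i, P * A i = -(A i * P)) (hPB : ∀ i, P * B i = -(B i * P)) {v : X → ℝ} {σ : ℝ}
    (hv : v ≠ 0) (hσ : |σ| = 1) (hPv : P v = σ • v) {w : ι → ℝ} (hw₀ : w ≠ 0)
    (hw : Matrix.vecMul w M = 0) {ρ : ℝ} (hρ : |ρ| = 1) :
    ∃ Ω : X → ℝ, Ω ≠ 0 ∧ P Ω = ρ • Ω ∧ Ω ⬝ᵥ majoranaForm A B M Ω = T * (Ω ⬝ᵥ Ω) := by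
  obtain ⟨Ω, τ, hΩ, hτ, hPΩ, hform⟩ := h.exists_dotProduct_form_eq hT hPA hPB hv hσ hPv
  rcases abs_eq_abs.1 (hτ.trans hρ.symm) with rfl | rfl
  · exact ⟨Ω, hΩ, hPΩ, hform⟩
  · refine ⟨mode B w Ω, h.mode_right_ne_zero hw₀ hΩ, ?_, h.dotProduct_form_mode_right hw hform⟩
    have hP := LinearMap.congr_fun (mode_mul_eq_neg hPB w) Ω
    rwa [Module.End.mul_apply, LinearMap.neg_apply, Module.End.mul_apply, hPΩ, neg_smul, map_neg,
      neg_neg, map_smul] at hP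

end IsMajorana

end Majorana

section JordanWigner

variable {L : ℕ}

/-- The configuration in which the single site `j` is flipped. -/
def flipAt (j : Fin L) (η : Config L) : Config L := Function.update η j (!(η j))

lemma flipAt_apply (j : Fin L) (η : Config L) (i : Fin L) :
    flipAt j η i = if i = j then !(η j) else η i :=
  Function.update_apply η j _ i

lemma flipAt_involutive (j : Fin L) : Function.Involutive (flipAt j) := fun η => by
  simp [flipAt]

lemma flipAt_comm (i j : Fin L) (η : Config L) :
    flipAt i (flipAt j η) = flipAt j (flipAt i η) := by
  rcases eq_or_ne i j with rfl | h
  · rfl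
  · simp [flipAt, Function.update_comm h, Function.update_of_ne h, Function.update_of_ne h.symm]

/-- The eigenvalue of the Pauli matrix `σᶻ`: `1` for an empty site, `-1` for an occupied one. -/
def spin (b : Bool) : ℝ := if b then -1 else 1

lemma spin_not (b : Bool) : spin (!b) = -spin b := by cases b <;> simp [spin]

lemma spin_mul_self (b : Bool) : spin b * spin b = 1 := by cases b <;> simp [spin]

lemma spin_apply (η : Config L) (k : Fin L) : spin (η k) = 1 - 2 * (occ η k : ℝ) := by
  unfold spin occ; cases η k <;> norm_num

/-- The eigenvalue of the product of the Pauli matrices `σᶻ` over the sites in `s`. -/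
def spinProd (s : Finset (Fin L)) (η : Config L) : ℝ := ∏ i ∈ s, spin (η i)

lemma spinProd_empty (η : Config L) : spinProd ∅ η = 1 := Finset.prod_empty

lemma spinProd_mul_self (s : Finset (Fin L)) (η : Config L) :
    spinProd s η * spinProd s η = 1 := by
  rw [spinProd, ← Finset.prod_mul_distrib]
  exact Finset.prod_eq_one fun i _ => spin_mul_self _

lemma spin_flipAt (k j : Fin L) (η : Config L) :
    spin (flipAt k η j) = (if k = j then -1 else 1) * spin (η j) := by
  rcases eq_or_ne k j with rfl | h
  · simp [flipAt_apply, spin_not]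
  · simp [flipAt_apply, h, h.symm]

lemma spinProd_flipAt (s : Finset (Fin L)) (k : Fin L) (η : Config L) :
    spinProd s (flipAt k η) = (if k ∈ s then -1 else 1) * spinProd s η := by
  simp only [spinProd, spin_flipAt, Finset.prod_mul_distrib, Finset.prod_ite_eq]

lemma spinProd_Iic (j : Fin L) (η : Config L) :
    spinProd (Finset.Iic j) η = spinProd (Finset.Iio j) η * spin (η j) := by
  rw [← Finset.Iio_insert, spinProd, Finset.prod_insert Finset.notMem_Iio_self, mul_comm, spinProd]

/-- The product of the Pauli matrices `σᶻ` over `s`, times the Pauli matrix `σˣ` of the site `j`,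
acting on functions of the configuration. -/
def pauliString (s : Finset (Fin L)) (j : Fin L) : Module.End ℝ (Config L → ℝ) :=
  LinearMap.mulLeft ℝ (spinProd s) ∘ₗ LinearMap.funLeft ℝ ℝ (flipAt j)

lemma pauliString_apply (s : Finset (Fin L)) (j : Fin L) (f : Config L → ℝ) (η : Config L) :
    pauliString s j f η = spinProd s η * f (flipAt j η) := rfl

lemma pauliString_mul_eq_neg {s t : Finset (Fin L)} {i j : Fin L} (h : i ∈ t ↔ j ∉ s) :
    pauliString s i * pauliString t j = -(pauliString t j * pauliString s i) := by
  refine LinearMap.ext fun f => funext fun η => ?_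
  simp only [LinearMap.neg_apply, Module.End.mul_apply, Pi.neg_apply, pauliString_apply,
    spinProd_flipAt, flipAt_comm i j, h]
  split_ifs <;> ring

lemma pauliString_mul_self (s : Finset (Fin L)) (j : Fin L) :
    pauliString s j * pauliString s j = (if j ∈ s then (-1 : ℝ) else 1) • 1 := by
  refine LinearMap.ext fun f => funext fun η => ?_
  simp only [Module.End.mul_apply, pauliString_apply, spinProd_flipAt, flipAt_involutive j η,
    LinearMap.smul_apply, Module.End.one_apply, Pi.smul_apply, smul_eq_mul]
  linear_combination (if j ∈ s then -1 else 1) * f η * spinProd_mul_self s η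

lemma pauliString_dotProduct (s : Finset (Fin L)) (j : Fin L) (f g : Config L → ℝ) :
    pauliString s j f ⬝ᵥ g = (if j ∈ s then -1 else 1) * (f ⬝ᵥ pauliString s j g) := by
  simp only [dotProduct, pauliString_apply, Finset.mul_sum]
  rw [← Equiv.sum_comp (flipAt_involutive j).toPerm]
  simp only [Function.Involutive.coe_toPerm, flipAt_involutive j _, spinProd_flipAt]
  exact Finset.sum_congr rfl fun η _ => by ring

/-- The Jordan–Wigner operator `σᶻ_0 ⋯ σᶻ_{j-1} σˣ_j`. -/
def jwA (j : Fin L) : Module.End ℝ (Config L → ℝ) := pauliString (Finset.Iio j) j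

/-- The Jordan–Wigner operator `σᶻ_0 ⋯ σᶻ_j σˣ_j`. -/
def jwB (j : Fin L) : Module.End ℝ (Config L → ℝ) := pauliString (Finset.Iic j) j

/-- The particle number parity operator `∏ k, σᶻ_k`. -/
def parityOp (L : ℕ) : Module.End ℝ (Config L → ℝ) := LinearMap.mulLeft ℝ (spinProd Finset.univ)

lemma parityOp_apply (f : Config L → ℝ) (η : Config L) :
    parityOp L f η = spinProd Finset.univ η * f η := rfl

lemma isMajorana_jw : IsMajorana (jwA (L := L)) jwB where
  mul_add_mul_left i j := by
    rcases eq_or_ne i j with rfl | h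
    · rw [jwA, pauliString_mul_self, if_pos rfl, if_neg Finset.notMem_Iio_self, ← two_smul ℝ,
        smul_smul, mul_one]
    · rw [jwA, jwA, pauliString_mul_eq_neg (by simp [h.le_iff_lt]), neg_add_cancel, if_neg h,
        zero_smul]
  mul_add_mul_right i j := by
    rcases eq_or_ne i j with rfl | h
    · rw [jwB, pauliString_mul_self, if_pos rfl, if_pos (Finset.mem_Iic.2 le_rfl), ← two_smul ℝ,
        smul_smul, mul_neg_one]
    · rw [jwB, jwB, pauliString_mul_eq_neg (by simp [h.le_iff_lt]), neg_add_cancel, if_neg h,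
        zero_smul]
  mul_eq_neg i j := pauliString_mul_eq_neg (by simp)
  symm_left j f g := by rw [jwA, pauliString_dotProduct, if_neg Finset.notMem_Iio_self, one_mul]
  antisymm_right j f g := by
    rw [jwB, pauliString_dotProduct, if_pos (Finset.mem_Iic.2 le_rfl), neg_one_mul]

lemma parityOp_mul_pauliString (s : Finset (Fin L)) (j : Fin L) :
    parityOp L * pauliString s j = -(pauliString s j * parityOp L) := by
  refine LinearMap.ext fun f => funext fun η => ?_
  simp only [Module.End.mul_apply, LinearMap.neg_apply, Pi.neg_apply, parityOp_apply,
    pauliString_apply, spinProd_flipAt, Finset.mem_univ, if_true]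
  ring

lemma finRotate_val (k : Fin L) :
    (finRotate L k : ℕ) = if (k : ℕ) + 1 = L then 0 else (k : ℕ) + 1 := by
  obtain _ | n := L
  · exact k.elim0
  · split_ifs with h
    · rw [show k = Fin.last n from Fin.ext (by simpa using h), finRotate_last, Fin.val_zero]
    · exact coe_finRotate_of_ne_last fun h' => h (by simp [h'])

lemma Iio_finRotate {k : Fin L} (hk : (k : ℕ) + 1 ≠ L) :
    Finset.Iio (finRotate L k) = Finset.Iic k := by
  ext i
  rw [Finset.mem_Iio, Finset.mem_Iic, Fin.lt_def, Fin.le_def, finRotate_val, if_neg hk,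
    Nat.lt_succ_iff]

lemma Iio_finRotate_last {k : Fin L} (hk : (k : ℕ) + 1 = L) :
    Finset.Iio (finRotate L k) = ∅ := by
  ext i
  rw [Finset.mem_Iio, Fin.lt_def, finRotate_val, if_pos hk]
  simp

lemma Iic_last {k : Fin L} (hk : (k : ℕ) + 1 = L) : Finset.Iic k = Finset.univ := by
  ext i
  simp only [Finset.mem_Iic, Fin.le_def, Finset.mem_univ, iff_true]
  omega

lemma finRotate_ne (hL : 2 ≤ L) (k : Fin L) : finRotate L k ≠ k := by
  intro h
  have hk := finRotate_val k
  rw [h] at hk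
  split_ifs at hk <;> omega

lemma flip_eq_flipAt (hL : 2 ≤ L) (η : Config L) (k : Fin L) :
    flip η k = flipAt (finRotate L k) (flipAt k η) := by
  have hk := finRotate_ne hL k
  funext j
  simp only [flip, flipAt_apply, hk, if_false]
  grind

lemma flip_involutive (hL : 2 ≤ L) (k : Fin L) :
    Function.Involutive fun η : Config L => flip η k := fun η => by
  simp only [flip_eq_flipAt hL]
  rw [flipAt_comm k, flipAt_involutive, flipAt_involutive]

lemma spinProd_univ_flip (hL : 2 ≤ L) (η : Config L) (k : Fin L) :
    spinProd Finset.univ (flip η k) = spinProd Finset.univ η := by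
  simp [flip_eq_flipAt hL, spinProd_flipAt]

/-- The sign of the bond `(k, k + 1)` under the boundary condition `τ`: the factor `τ` sits on the
bond `(L - 1, 0)`. -/
def bondSign (L : ℕ) (τ : ℝ) (k : Fin L) : ℝ := if (k : ℕ) + 1 = L then τ else 1

/-- The symmetrized rate of the bond `(k, k + 1)`: `1 / 2` if the occupation numbers differ,
`γ / 2` if they agree. -/
def bondRate (γ : ℝ) (k : Fin L) (η : Config L) : ℝ :=
  (1 + γ) / 4 - (1 - γ) / 4 * (spin (η k) * spin (η (finRotate L k)))

/-- The XY chain with boundary condition `τ` in the `σᶻ` basis. -/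
def xyChain (L : ℕ) (τ γ μ : ℝ) : Module.End ℝ (Config L → ℝ) :=
  hopping (fun k η => flip η k) (fun k η => bondSign L τ k * bondRate γ k η) (exitRate (1 / 2) μ)

lemma bondRate_flip (hL : 2 ≤ L) (γ : ℝ) (k : Fin L) (η : Config L) :
    bondRate γ k (flip η k) = bondRate γ k η := by
  simp [bondRate, flip_eq_flipAt hL, spin_flipAt, finRotate_ne hL k, (finRotate_ne hL k).symm,
    -finRotate_apply]

lemma bondRate_pos {γ : ℝ} (hγ : 0 < γ) (k : Fin L) (η : Config L) : 0 < bondRate γ k η := by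
  unfold bondRate
  cases η k <;> cases η (finRotate L k) <;> simp [spin] <;> linarith

/-- The shift matrix of the ring, with the boundary condition `θ`. -/
def shiftMatrix (L : ℕ) (θ : ℝ) : Matrix (Fin L) (Fin L) ℝ :=
  Matrix.of fun j l => if l = finRotate L j then bondSign L θ j else 0

/-- The coefficient matrix of the XY chain as a quadratic form in Majorana operators. -/
def xyMatrix (L : ℕ) (γ θ : ℝ) : Matrix (Fin L) (Fin L) ℝ :=
  (1 / 2 : ℝ) • 1 - ((1 + γ) / 4) • shiftMatrix L θ - ((1 - γ) / 4) • (shiftMatrix L θ).transpose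

lemma jwB_jwA_self (f : Config L → ℝ) (k : Fin L) (η : Config L) :
    jwB k (jwA k f) η = spin (η k) * f η := by
  rw [jwB, jwA, pauliString_apply, pauliString_apply, flipAt_involutive, spinProd_flipAt,
    if_neg Finset.notMem_Iio_self, spinProd_Iic]
  linear_combination spin (η k) * f η * spinProd_mul_self (Finset.Iio k) η

variable {σ θ : ℝ} {f : Config L → ℝ}

lemma spinProd_mul_flip_of_parityOp (hL : 2 ≤ L) (hf : parityOp L f = σ • f) (k : Fin L)
    (η : Config L) : spinProd Finset.univ η * f (flip η k) = σ * f (flip η k) := by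
  have h := congrFun hf (flip η k)
  rwa [parityOp_apply, spinProd_univ_flip hL] at h

lemma jwB_jwA_finRotate (hL : 2 ≤ L) (hf : parityOp L f = σ • f) (k : Fin L) (η : Config L) :
    bondSign L θ k * jwB k (jwA (finRotate L k) f) η =
      -(bondSign L (-(σ * θ)) k * f (flip η k)) := by
  rw [jwB, jwA, pauliString_apply, pauliString_apply, ← flip_eq_flipAt hL, bondSign, bondSign]
  split_ifs with hk
  · rw [Iio_finRotate_last hk, Iic_last hk, spinProd_empty, one_mul,
      spinProd_mul_flip_of_parityOp hL hf]
    ring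
  · rw [Iio_finRotate hk, spinProd_flipAt, if_pos (Finset.mem_Iic.2 le_rfl)]
    linear_combination -f (flip η k) * spinProd_mul_self (Finset.Iic k) η

lemma jwB_finRotate_jwA (hL : 2 ≤ L) (hf : parityOp L f = σ • f) (k : Fin L) (η : Config L) :
    bondSign L θ k * jwB (finRotate L k) (jwA k f) η =
      bondSign L (-(σ * θ)) k * (spin (η k) * spin (η (finRotate L k))) * f (flip η k) := by
  rw [jwB, jwA, pauliString_apply, pauliString_apply, flipAt_comm, ← flip_eq_flipAt hL, bondSign,
    bondSign, spinProd_Iic, spinProd_flipAt]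
  split_ifs with hk hmem hmem
  · have hP := spinProd_mul_flip_of_parityOp hL hf k η
    rw [← Iic_last hk, spinProd_Iic] at hP
    rw [Iio_finRotate_last hk, spinProd_empty]
    linear_combination -θ * spin (η (finRotate L k)) * (spin (η k) * hP -
      spinProd (Finset.Iio k) η * f (flip η k) * spin_mul_self (η k))
  · exact absurd (by simp only [Finset.mem_Iio, Fin.lt_def, finRotate_val, hk, if_true]; omega) hmem
  · simp only [Finset.mem_Iio, Fin.lt_def, finRotate_val, hk, if_false] at hmem
    omega
  · rw [Iio_finRotate hk, spinProd_Iic]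
    linear_combination spin (η k) * spin (η (finRotate L k)) * f (flip η k) *
      spinProd_mul_self (Finset.Iio k) η

lemma sum_spin (η : Config L) : ∑ k, spin (η k) = L - 2 * particleNumber η := by
  simp [spin_apply, particleNumber, Finset.mul_sum]

lemma exitRate_half (μ : ℝ) (η : Config L) :
    exitRate (1 / 2) μ η = L * μ + particleNumber η := by
  have hrotate : ∑ k, (occ η (finRotate L k) : ℝ) = ∑ k, (occ η k : ℝ) :=
    Equiv.sum_comp (finRotate L) fun k => (occ η k : ℝ)
  simp only [exitRate, Finset.sum_add_distrib, ← Finset.mul_sum, hrotate, particleNumber,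
    Finset.sum_const, Finset.card_univ, Fintype.card_fin, nsmul_eq_mul, Nat.cast_sum]
  ring

/-- In the sector of parity `σ` the fermionic boundary condition `θ` becomes the boundary
condition `-(σ * θ)` of the spins. -/
theorem majoranaForm_xyMatrix (hL : 2 ≤ L) (γ μ : ℝ) (hf : parityOp L f = σ • f) :
    majoranaForm jwA jwB (xyMatrix L γ θ) f =
      xyChain L (-(σ * θ)) γ μ f + (L * (μ + 1 / 2)) • f := by
  funext η
  have hone : majoranaForm jwA jwB 1 f η = (L - 2 * particleNumber η) * f η := by
    simp [majoranaForm_apply_apply, Matrix.one_apply, jwB_jwA_self, ← Finset.sum_mul, sum_spin]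
  have hshift : majoranaForm jwA jwB (shiftMatrix L θ) f η =
      -∑ k, bondSign L (-(σ * θ)) k * f (flip η k) := by
    rw [majoranaForm_apply_apply, ← Finset.sum_neg_distrib]
    simp [shiftMatrix, ← jwB_jwA_finRotate hL hf, -finRotate_apply]
  have htranspose : majoranaForm jwA jwB (shiftMatrix L θ).transpose f η =
      ∑ k, bondSign L (-(σ * θ)) k * (spin (η k) * spin (η (finRotate L k))) * f (flip η k) := by
    rw [majoranaForm_apply_apply, Finset.sum_comm]
    simp [shiftMatrix, ← jwB_finRotate_jwA hL hf, -finRotate_apply]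
  have hchain : ∑ k, bondSign L (-(σ * θ)) k * bondRate γ k η * f (flip η k) =
      (1 + γ) / 4 * ∑ k, bondSign L (-(σ * θ)) k * f (flip η k) - (1 - γ) / 4 *
        ∑ k, bondSign L (-(σ * θ)) k * (spin (η k) * spin (η (finRotate L k))) * f (flip η k) := by
    rw [Finset.mul_sum, Finset.mul_sum, ← Finset.sum_sub_distrib]
    exact Finset.sum_congr rfl fun k _ => by rw [bondRate]; ring
  simp only [xyMatrix, map_sub, map_smul, LinearMap.sub_apply, LinearMap.smul_apply, Pi.sub_apply,
    Pi.smul_apply, Pi.add_apply, smul_eq_mul, hone, hshift, htranspose, xyChain, hopping_apply,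
    hchain, exitRate_half]
  ring

end JordanWigner

section Irreducibility

variable {L : ℕ}

/-- The configurations of parity `σ`, namely `σ = 1` for an even and `σ = -1` for an odd number of
particles. -/
def sector (L : ℕ) (σ : ℝ) : Set (Config L) := {η | spinProd Finset.univ η = σ}

lemma mapsTo_flip_sector (hL : 2 ≤ L) (σ : ℝ) (k : Fin L) :
    Set.MapsTo (fun η => flip η k) (sector L σ) (sector L σ) :=
  fun η hη => (spinProd_univ_flip hL η k).trans hη

lemma parityOp_eq_smul_iff {σ : ℝ} {f : Config L → ℝ} :
    parityOp L f = σ • f ↔ f ∈ supportedOn (sector L σ) := by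
  simp only [funext_iff, parityOp_apply, Pi.smul_apply, smul_eq_mul, mem_supportedOn, sector,
    Set.mem_ofPred_eq, mul_eq_mul_right_iff, or_iff_not_imp_left]

lemma eq_univ_of_mapsTo_flipAt {W : Set (Config L)} (hW : ∀ j, Set.MapsTo (flipAt j) W W)
    (hne : W.Nonempty) : W = Set.univ := by
  obtain ⟨x, hx⟩ := hne
  refine Set.eq_univ_of_forall fun y => ?_
  have hmem (s : Finset (Fin L)) : s.piecewise y x ∈ W := by
    induction s using Finset.induction_on with
    | empty => rwa [Finset.piecewise_empty]
    | insert j s hj ih =>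
      rw [Finset.piecewise_insert]
      by_cases h : y j = x j
      · rwa [h, ← Finset.piecewise_eq_of_notMem s y x hj, Function.update_eq_self]
      · have hflip := hW j ih
        rwa [flipAt, Finset.piecewise_eq_of_notMem s y x hj, ← Bool.eq_not_of_ne h] at hflip
  rw [← Finset.piecewise_univ y x]
  exact hmem _

lemma flipAt_flipAt_zero_mem {n : ℕ} (hn : 2 ≤ n + 1) {Z : Set (Config (n + 1))}
    (hZ : ∀ k, Set.MapsTo (fun η => flip η k) Z Z) {z : Config (n + 1)} (hz : z ∈ Z)
    (j : Fin (n + 1)) : flipAt j (flipAt 0 z) ∈ Z := by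
  induction j using Fin.induction with
  | zero => rwa [flipAt_involutive]
  | succ i ih =>
    have hflip : flip _ i.castSucc ∈ Z := hZ i.castSucc ih
    have hrotate : finRotate (n + 1) i.castSucc = i.succ := finRotate_of_lt i.2
    rwa [flip_eq_flipAt hn, flipAt_involutive, hrotate] at hflip

/-- A pair of flips at neighbouring sites can be composed to a pair of flips at the sites `0` and
`j`, so modulo parity every site can be flipped separately. -/
lemma sector_subset_of_mapsTo_flip (hL : 2 ≤ L) {σ : ℝ} (Z : Set (Config L))
    (hZ : ∀ k, Set.MapsTo (fun η => flip η k) Z Z) (hne : (Z ∩ sector L σ).Nonempty) :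
    sector L σ ⊆ Z := by
  obtain _ | n := L
  · omega
  have hZσ (k : Fin (n + 1)) : Set.MapsTo (fun η => flip η k) (Z ∩ sector (n + 1) σ)
      (Z ∩ sector (n + 1) σ) := (hZ k).inter_inter (mapsTo_flip_sector hL σ k)
  have huniv : {y | y ∈ Z ∩ sector (n + 1) σ ∨ flipAt 0 y ∈ Z ∩ sector (n + 1) σ} = Set.univ := by
    refine eq_univ_of_mapsTo_flipAt (fun j y hy => ?_) (hne.mono fun _ => Or.inl)
    rcases hy with hy | hy
    · exact Or.inr (flipAt_comm 0 j y ▸ flipAt_flipAt_zero_mem hL hZσ hy j)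
    · have hj := flipAt_flipAt_zero_mem hL hZσ hy j
      rw [flipAt_involutive] at hj
      exact Or.inl hj
  intro y (hy : spinProd Finset.univ y = σ)
  rcases Set.eq_univ_iff_forall.1 huniv y with h | ⟨-, hodd⟩
  · exact h.1
  · rw [sector, Set.mem_ofPred_eq, spinProd_flipAt, if_pos (Finset.mem_univ _), hy] at hodd
    nlinarith [spinProd_mul_self Finset.univ y]

end Irreducibility

section TraceNorm

open Matrix ComplexConjugate

variable {ι : Type*} [Fintype ι] [DecidableEq ι]

/-- The entrywise inclusion of the real matrices into the complex ones. -/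
def complexify : Matrix ι ι ℝ →ₐ[ℝ] Matrix ι ι ℂ := Complex.ofRealAm.mapMatrix

lemma complexify_apply (M : Matrix ι ι ℝ) (i j : ι) : complexify M i j = (M i j : ℂ) := rfl

lemma complexify_injective : Function.Injective (complexify (ι := ι)) :=
  Matrix.map_injective Complex.ofReal_injective

lemma complexify_transpose (M : Matrix ι ι ℝ) : complexify Mᵀ = star (complexify M) := by
  ext i j
  simp [complexify_apply, star_apply]

lemma trace_complexify (M : Matrix ι ι ℝ) : (complexify M).trace = (M.trace : ℂ) := by
  simp [Matrix.trace, complexify_apply]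

/-- The normal matrix whose eigenvectors are the columns of the unitary matrix `E`, as a function of
its eigenvalues. -/
def spectralMatrix (E : unitary (Matrix ι ι ℂ)) : (ι → ℂ) →ₐ[ℝ] Matrix ι ι ℂ :=
  (Unitary.conjStarAlgAut ℝ (Matrix ι ι ℂ) E).toAlgEquiv.toAlgHom.comp (diagonalAlgHom ℝ)

variable (E : unitary (Matrix ι ι ℂ))

lemma spectralMatrix_eq (d : ι → ℂ) :
    spectralMatrix E d = (E : Matrix ι ι ℂ) * diagonal d * star (E : Matrix ι ι ℂ) := rfl

lemma spectralMatrix_star (d : ι → ℂ) : spectralMatrix E (star d) = star (spectralMatrix E d) := by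
  rw [spectralMatrix_eq, spectralMatrix_eq, star_mul, star_mul, star_star,
    star_eq_conjTranspose (diagonal d), diagonal_conjTranspose, Matrix.mul_assoc]

lemma trace_spectralMatrix (d : ι → ℂ) : (spectralMatrix E d).trace = ∑ q, d q := by
  rw [spectralMatrix_eq, Matrix.trace_mul_comm, ← Matrix.mul_assoc, Unitary.coe_star_mul_self,
    Matrix.one_mul, trace_diagonal]

variable {E} {ρ : Equiv.Perm ι}
  (hE : ∀ j q, (E : Matrix ι ι ℂ) j (ρ q) = conj ((E : Matrix ι ι ℂ) j q))

include hE

lemma exists_complexify_eq_spectralMatrix {d : ι → ℂ} (hd : ∀ q, d (ρ q) = conj (d q)) :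
    ∃ N : Matrix ι ι ℝ, complexify N = spectralMatrix E d := by
  refine ⟨(spectralMatrix E d).map Complex.re, ext fun j l => Complex.conj_eq_iff_re.1 ?_⟩
  have hentry : spectralMatrix E d j l =
      ∑ q, (E : Matrix ι ι ℂ) j q * d q * conj ((E : Matrix ι ι ℂ) l q) := by
    rw [spectralMatrix_eq, mul_apply]
    simp only [mul_diagonal, star_apply, starRingEnd_apply]
  rw [hentry, map_sum, ← Equiv.sum_comp ρ]
  simp only [hE, hd, map_mul, Complex.conj_conj]

omit [Fintype ι] [DecidableEq ι] hE in
lemma exists_phase {m : ι → ℂ} (hm : ∀ q, m (ρ q) = conj (m q)) :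
    ∃ u : ι → ℂ, (∀ q, u (ρ q) = conj (u q)) ∧ (u * star u = 1) ∧
      ∀ q, u q * ‖m q‖ = m q := by
  refine ⟨fun q => if m q = 0 then 1 else m q / ‖m q‖, fun q => ?_, funext fun q => ?_,
    fun q => ?_⟩
  · by_cases h : m q = 0 <;> simp [hm, h]
  · by_cases h : m q = 0
    · simp [h]
    · have hnorm : (‖m q‖ : ℂ) ≠ 0 := by simpa using h
      simp only [Pi.mul_apply, Pi.star_apply, h, if_false, star_div₀, RCLike.star_def,
        Complex.conj_ofReal, div_mul_div_comm, Complex.mul_conj', ← sq,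
        div_self (pow_ne_zero 2 hnorm), Pi.one_apply]
  · by_cases h : m q = 0 <;> simp [h]

theorem isTraceNorm_of_complexify_eq_spectralMatrix {M : Matrix ι ι ℝ} {m : ι → ℂ}
    (hm : ∀ q, m (ρ q) = conj (m q)) (hM : complexify M = spectralMatrix E m) :
    IsTraceNorm M (∑ q, ‖m q‖) := by
  obtain ⟨u, hu, huu, hum⟩ := exists_phase hm
  set r : ι → ℂ := fun q => (Real.sqrt ‖m q‖ : ℝ) with hr
  have hrr : r * r = fun q => (‖m q‖ : ℂ) := funext fun q => by
    simp only [hr, Pi.mul_apply, ← Complex.ofReal_mul, Real.mul_self_sqrt (norm_nonneg _)]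
  have hrs : star r = r := funext fun q => by simp [hr]
  have hm' : m = u * (r * r) := by rw [hrr]; exact funext fun q => (hum q).symm
  have hrρ : ∀ q, r (ρ q) = conj (r q) := fun q => by simp [hr, hm]
  obtain ⟨U, hU⟩ := exists_complexify_eq_spectralMatrix hE hu
  obtain ⟨R, hR⟩ := exists_complexify_eq_spectralMatrix hE hrρ
  have htrace : (spectralMatrix E (r * r)).trace = ((∑ q, ‖m q‖ : ℝ) : ℂ) := by
    rw [trace_spectralMatrix, hrr, Complex.ofReal_sum]
  refine ⟨U, U * R, R, complexify_injective ?_, Complex.ofReal_injective ?_,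
    complexify_injective ?_, Complex.ofReal_injective ?_⟩
  · rw [map_mul, complexify_transpose, hU, ← spectralMatrix_star, ← map_mul, huu, map_one, map_one]
  · rw [← trace_complexify, map_mul, complexify_transpose, hM, hU, ← spectralMatrix_star,
      ← map_mul, ← htrace, hm', mul_right_comm, huu, one_mul]
  · rw [map_mul, map_mul, hU, hR, hM, ← map_mul, ← map_mul, hm', mul_assoc]
  · have hWW : u * r * star (u * r) = r * r := by
      rw [star_mul, hrs, mul_assoc, ← mul_assoc r, mul_comm (r * r), ← mul_assoc, huu, one_mul]
    rw [Complex.ofReal_div, Complex.ofReal_add, ← trace_complexify, ← trace_complexify]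
    simp only [map_mul, complexify_transpose, hU, hR]
    rw [← map_mul, ← spectralMatrix_star, ← spectralMatrix_star, ← map_mul, ← map_mul, hWW, hrs,
      htrace, Complex.ofReal_ofNat]
    ring

end TraceNorm

section Fourier

open Matrix ComplexConjugate

variable {L : ℕ}

/-- The momenta `z q` of a ring of `L` sites with the boundary condition `θ`, as points of the unit
circle, together with the reflection `ρ` that conjugates them. -/
structure IsMomenta (z : Fin L → ℂ) (ρ : Equiv.Perm (Fin L)) (θ : ℝ) : Prop where
  pow : ∀ q, z q ^ L = θ
  norm : ∀ q, ‖z q‖ = 1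
  injective : Function.Injective z
  reflect : ∀ q, z (ρ q) = conj (z q)

variable {z : Fin L → ℂ} {ρ : Equiv.Perm (Fin L)} {θ : ℝ}

/-- The matrix whose columns are the plane waves with the momenta `z`, normalized. -/
def planeWaveMatrix (z : Fin L → ℂ) : Matrix (Fin L) (Fin L) ℂ :=
  Matrix.of fun j q => z q ^ (j : ℕ) / (Real.sqrt L : ℂ)

lemma star_planeWaveMatrix_mul_apply (hz : ∀ q, ‖z q‖ = 1) (p q : Fin L) :
    (star (planeWaveMatrix z) * planeWaveMatrix z) p q =
      (∑ j ∈ Finset.range L, ((z p)⁻¹ * z q) ^ j) / L := by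
  have hsqrt : ((Real.sqrt L : ℝ) : ℂ) * (Real.sqrt L : ℝ) = L := by
    rw [← Complex.ofReal_mul, Real.mul_self_sqrt (Nat.cast_nonneg _), Complex.ofReal_natCast]
  have hconj : star (z p) = (z p)⁻¹ := by
    rw [Complex.inv_def, Complex.normSq_eq_norm_sq, hz]; simp
  rw [mul_apply, Finset.sum_div,
    ← Fin.sum_univ_eq_sum_range (fun j => ((z p)⁻¹ * z q) ^ j / (L : ℂ))]
  refine Finset.sum_congr rfl fun j _ => ?_
  rw [star_apply, planeWaveMatrix, of_apply, of_apply, star_div₀, star_pow, hconj,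
    ← starRingEnd_apply, Complex.conj_ofReal, div_mul_div_comm, ← mul_pow, hsqrt]

lemma IsMomenta.ne_zero (hz : IsMomenta z ρ θ) (q : Fin L) : z q ≠ 0 :=
  norm_ne_zero_iff.1 (by rw [hz.norm]; exact one_ne_zero)

lemma IsMomenta.star_planeWaveMatrix_mul (hz : IsMomenta z ρ θ) :
    star (planeWaveMatrix z) * planeWaveMatrix z = 1 := by
  ext p q
  rw [star_planeWaveMatrix_mul_apply hz.norm, one_apply]
  split_ifs with hpq
  · have hL : (L : ℂ) ≠ 0 := Nat.cast_ne_zero.2 p.pos.ne'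
    rw [hpq, inv_mul_cancel₀ (hz.ne_zero q)]
    simp [hL]
  · have hne : (z p)⁻¹ * z q ≠ 1 := fun h =>
      hpq (hz.injective ((inv_mul_eq_one₀ (hz.ne_zero p)).1 h))
    have hpow : ((z p)⁻¹ * z q) ^ L = 1 := by
      rw [mul_pow, inv_pow, hz.pow q, ← hz.pow p,
        inv_mul_cancel₀ (pow_ne_zero _ (hz.ne_zero p))]
    rw [geom_sum_eq hne, hpow, sub_self, zero_div, zero_div]

lemma IsMomenta.planeWaveMatrix_mem_unitary (hz : IsMomenta z ρ θ) :
    planeWaveMatrix z ∈ unitary (Matrix (Fin L) (Fin L) ℂ) :=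
  ⟨hz.star_planeWaveMatrix_mul, mul_eq_one_comm.1 hz.star_planeWaveMatrix_mul⟩

lemma IsMomenta.planeWaveMatrix_reflect (hz : IsMomenta z ρ θ) (j q : Fin L) :
    planeWaveMatrix z j (ρ q) = conj (planeWaveMatrix z j q) := by
  simp [planeWaveMatrix, hz.reflect]

lemma IsMomenta.complexify_shiftMatrix_mul (hz : IsMomenta z ρ θ) :
    complexify (shiftMatrix L θ) * planeWaveMatrix z = planeWaveMatrix z * diagonal z := by
  ext j q
  rw [mul_diagonal, mul_apply, Finset.sum_eq_single (finRotate L j)]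
  · simp only [shiftMatrix, complexify_apply, of_apply, if_true, planeWaveMatrix, finRotate_val,
      bondSign, div_mul_eq_mul_div, ← pow_succ]
    split_ifs with hj
    · rw [hj, hz.pow, pow_zero, mul_one_div]
    · rw [Complex.ofReal_one, one_mul]
  · intro l _ hl
    rw [complexify_apply, shiftMatrix, of_apply, if_neg hl, Complex.ofReal_zero, zero_mul]
  · simp

lemma IsMomenta.complexify_shiftMatrix (hz : IsMomenta z ρ θ) :
    complexify (shiftMatrix L θ) = spectralMatrix ⟨_, hz.planeWaveMatrix_mem_unitary⟩ z := by
  rw [spectralMatrix_eq, ← hz.complexify_shiftMatrix_mul, Matrix.mul_assoc,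
    hz.planeWaveMatrix_mem_unitary.2, Matrix.mul_one]

/-- The symbol of `xyMatrix`: its eigenvalue at the momentum `w`. -/
def xySymbol (γ : ℝ) (w : ℂ) : ℂ :=
  (1 / 2 : ℝ) - ((1 + γ) / 4 : ℝ) * w - ((1 - γ) / 4 : ℝ) * conj w

lemma IsMomenta.complexify_xyMatrix (hz : IsMomenta z ρ θ) (γ : ℝ) :
    complexify (xyMatrix L γ θ) =
      spectralMatrix ⟨_, hz.planeWaveMatrix_mem_unitary⟩ fun q => xySymbol γ (z q) := by
  have hsymbol : (fun q => xySymbol γ (z q)) =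
      (1 / 2 : ℝ) • (1 : Fin L → ℂ) - ((1 + γ) / 4) • z - ((1 - γ) / 4) • star z := by
    funext q
    simp [xySymbol]
  rw [hsymbol, xyMatrix]
  simp only [map_sub, map_smul, map_one, complexify_transpose, hz.complexify_shiftMatrix,
    spectralMatrix_star]

theorem IsMomenta.isTraceNorm_xyMatrix (hz : IsMomenta z ρ θ) (γ : ℝ) :
    IsTraceNorm (xyMatrix L γ θ) (∑ q, ‖xySymbol γ (z q)‖) :=
  isTraceNorm_of_complexify_eq_spectralMatrix hz.planeWaveMatrix_reflect
    (fun q => by simp only [xySymbol, hz.reflect, map_sub, map_mul, Complex.conj_ofReal]) <|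
    hz.complexify_xyMatrix γ

end Fourier

section Momenta

open ComplexConjugate

/-- The points `exp (2 π i (q + δ) / L)` of the unit circle. -/
def momentum (L : ℕ) (δ : ℝ) (q : Fin L) : ℂ := Circle.exp (2 * Real.pi * ((q + δ) / L))

variable {L : ℕ} {δ : ℝ}

lemma circleExp_two_pi_mul_eq_iff {x y : ℝ} :
    Circle.exp (2 * Real.pi * x) = Circle.exp (2 * Real.pi * y) ↔ ∃ n : ℤ, x = y + n := by
  rw [Circle.exp_eq_exp]
  refine exists_congr fun n => ?_
  rw [mul_comm (n : ℝ), ← mul_add, mul_right_inj' Real.two_pi_pos.ne']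

lemma momentum_injective (L : ℕ) (δ : ℝ) : Function.Injective (momentum L δ) := fun p q hpq => by
  have hL : (L : ℝ) ≠ 0 := Nat.cast_ne_zero.2 p.pos.ne'
  obtain ⟨n, hn⟩ := circleExp_two_pi_mul_eq_iff.1 (Subtype.coe_injective hpq)
  have hdiff : (p : ℤ) = q + n * L := by
    have : (p : ℝ) = q + n * L := by field_simp at hn; linarith
    exact_mod_cast this
  have hmod : (p : ℤ) % L = q % L := by rw [hdiff, Int.add_mul_emod_self_right]
  rw [Int.emod_eq_of_lt (by positivity) (by exact_mod_cast p.2),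
    Int.emod_eq_of_lt (by positivity) (by exact_mod_cast q.2)] at hmod
  exact Fin.ext (by exact_mod_cast hmod)

lemma momentum_pow (q : Fin L) : momentum L δ q ^ L = Circle.exp (2 * Real.pi * δ) := by
  have hL : (L : ℝ) ≠ 0 := Nat.cast_ne_zero.2 q.pos.ne'
  rw [momentum, ← Circle.coe_pow, ← Circle.exp_nsmul, nsmul_eq_mul, mul_left_comm,
    mul_div_cancel₀ _ hL]
  exact congrArg _ (circleExp_two_pi_mul_eq_iff.2 ⟨q, by rw [Int.cast_natCast, add_comm]⟩)

lemma momentum_eq_conj {p q : Fin L} (h : ∃ n : ℤ, (p + δ) + (q + δ) = n * (L : ℝ)) :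
    momentum L δ p = conj (momentum L δ q) := by
  obtain ⟨n, hn⟩ := h
  have hL : (L : ℝ) ≠ 0 := Nat.cast_ne_zero.2 q.pos.ne'
  rw [momentum, momentum, ← Circle.coe_inv_eq_conj, ← Circle.exp_neg, ← mul_neg]
  refine congrArg _ (circleExp_two_pi_mul_eq_iff.2 ⟨n, ?_⟩)
  field_simp
  linarith

lemma isMomenta_antiperiodic (L : ℕ) : IsMomenta (momentum L (1 / 2)) Fin.revPerm (-1) where
  pow q := by
    rw [momentum_pow, mul_one_div, mul_div_cancel_left₀ _ two_ne_zero, Circle.coe_exp]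
    simp
  norm q := Circle.norm_coe _
  injective := momentum_injective L _
  reflect q := momentum_eq_conj ⟨1, by
    have hrev : ((Fin.rev q : Fin L) : ℕ) + (q + 1) = L := by rw [Fin.val_rev]; omega
    have hrev' : (((Fin.rev q : Fin L) : ℕ) : ℝ) + (q + 1) = L := by exact_mod_cast hrev
    rw [Fin.revPerm_apply, Int.cast_one]
    linarith⟩

lemma isMomenta_periodic (L : ℕ) [NeZero L] :
    IsMomenta (momentum L 0) (Equiv.neg (Fin L)) 1 where
  pow q := by rw [momentum_pow, mul_zero, Circle.exp_zero]; simp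
  norm q := Circle.norm_coe _
  injective := momentum_injective L _
  reflect q := momentum_eq_conj <| by
    rcases eq_or_ne q 0 with rfl | hq
    · exact ⟨0, by simp⟩
    · have hneg : ((-q : Fin L) : ℕ) + q = L := by rw [Fin.val_neg, if_neg hq]; omega
      have hneg' : (((-q : Fin L) : ℕ) : ℝ) + q = L := by exact_mod_cast hneg
      exact ⟨1, by rw [Equiv.neg_apply, Int.cast_one]; linarith⟩

/-- The single-particle energy of the XY chain at the momentum `2 π x`. -/
def dispersion (ν x : ℝ) : ℝ :=
  Real.sin (Real.pi * x) * Real.sqrt (1 - ν ^ 2 * Real.cos (Real.pi * x) ^ 2)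

lemma normSq_xySymbol {ν γ : ℝ} (hγ : γ ^ 2 = 1 - ν ^ 2) (x : ℝ) :
    Complex.normSq (xySymbol γ (Circle.exp (2 * Real.pi * x))) =
      Real.sin (Real.pi * x) ^ 2 * (1 - ν ^ 2 * Real.cos (Real.pi * x) ^ 2) := by
  have hsc := Real.sin_sq_add_cos_sq (Real.pi * x)
  rw [Circle.coe_exp, Complex.exp_mul_I, ← Complex.ofReal_cos, ← Complex.ofReal_sin, mul_assoc,
    Real.cos_two_mul, Real.sin_two_mul, Complex.normSq_apply]
  simp only [xySymbol, Complex.sub_re, Complex.sub_im, Complex.add_re, Complex.add_im,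
    Complex.mul_re, Complex.mul_im, Complex.ofReal_re, Complex.ofReal_im, Complex.I_re,
    Complex.I_im, Complex.conj_re, Complex.conj_im]
  linear_combination (Real.cos (Real.pi * x) ^ 2 - 1) * hsc +
    Real.sin (Real.pi * x) ^ 2 * Real.cos (Real.pi * x) ^ 2 * hγ

lemma norm_xySymbol {ν γ : ℝ} (hγ : γ ^ 2 = 1 - ν ^ 2) {x : ℝ} (hx₀ : 0 ≤ x) (hx₁ : x ≤ 1) :
    ‖xySymbol γ (Circle.exp (2 * Real.pi * x))‖ = dispersion ν x := by
  have hsin : 0 ≤ Real.sin (Real.pi * x) :=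
    Real.sin_nonneg_of_nonneg_of_le_pi (by positivity) (mul_le_of_le_one_right Real.pi_pos.le hx₁)
  rw [Complex.norm_def, normSq_xySymbol hγ, Real.sqrt_mul (sq_nonneg _), Real.sqrt_sq hsin,
    dispersion]

/-- The ground state energy of `L` free modes with the momenta `momentum L δ`. -/
def dispersionSum (ν : ℝ) (L : ℕ) (δ : ℝ) : ℝ := ∑ q : Fin L, dispersion ν ((q + δ) / L)

lemma sum_norm_xySymbol_momentum {ν γ : ℝ} (hγ : γ ^ 2 = 1 - ν ^ 2) (hδ₀ : 0 ≤ δ) (hδ₁ : δ ≤ 1) :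
    ∑ q, ‖xySymbol γ (momentum L δ q)‖ = dispersionSum ν L δ := by
  refine Finset.sum_congr rfl fun q _ => norm_xySymbol hγ (by positivity) ?_
  have hq : (q : ℝ) + 1 ≤ L := by exact_mod_cast q.2
  exact div_le_one_of_le₀ (by linarith) (Nat.cast_nonneg _)

end Momenta

section LargestEigenvalue

variable {L : ℕ} {γ μ σ θ Λ T : ℝ}

lemma bondSign_one (k : Fin L) : bondSign L 1 k = 1 := ite_self 1

lemma xyChain_one (L : ℕ) (γ μ : ℝ) :
    xyChain L 1 γ μ = hopping (fun k η => flip η k) (bondRate γ) (exitRate (1 / 2) μ) := by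
  simp only [xyChain, bondSign_one, one_mul]

lemma sector_nonempty (hL : 2 ≤ L) (hσ : |σ| = 1) : (sector L σ).Nonempty := by
  have hempty : spinProd Finset.univ (fun _ => false : Config L) = 1 := by simp [spinProd, spin]
  rcases eq_or_eq_neg_of_abs_eq hσ with rfl | rfl
  · exact ⟨_, hempty⟩
  · refine ⟨flipAt ⟨0, by omega⟩ fun _ => false, ?_⟩
    rw [sector, Set.mem_ofPred_eq, spinProd_flipAt, hempty]
    simp

lemma exists_pos_eigenvector_isMaxRayleigh_xyChain (hL : 2 ≤ L) (hγ : 0 < γ) (μ : ℝ)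
    (hσ : |σ| = 1) :
    ∃ (Λ : ℝ) (φ : Config L → ℝ), IsMaxRayleigh (xyChain L 1 γ μ) (supportedOn (sector L σ)) Λ ∧
      (∀ η ∈ sector L σ, 0 < φ η) ∧ xyChain L 1 γ μ φ = Λ • φ := by
  obtain ⟨Λ, φ, hΛ, -, hφ, heig⟩ := exists_pos_eigenvector_isMaxRayleigh (flip_involutive hL)
    (bondRate_flip hL γ) (bondRate_pos hγ) (exitRate (1 / 2) μ) (sector_nonempty hL hσ)
    (mapsTo_flip_sector hL σ) (sector_subset_of_mapsTo_flip hL)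
  rw [← xyChain_one] at hΛ heig
  exact ⟨Λ, φ, hΛ, hφ, heig⟩

lemma dotProduct_majoranaForm_xyMatrix (hL : 2 ≤ L) (γ μ : ℝ) {f : Config L → ℝ}
    (hf : f ∈ supportedOn (sector L σ)) :
    f ⬝ᵥ majoranaForm jwA jwB (xyMatrix L γ θ) f =
      f ⬝ᵥ xyChain L (-(σ * θ)) γ μ f + L * (μ + 1 / 2) * (f ⬝ᵥ f) := by
  rw [majoranaForm_xyMatrix hL γ μ (parityOp_eq_smul_iff.2 hf), dotProduct_add, dotProduct_smul,
    smul_eq_mul]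

lemma dotProduct_xyChain_le_abs (hγ : 0 < γ) (μ : ℝ) {τ : ℝ} (hτ : |τ| ≤ 1) (f : Config L → ℝ) :
    f ⬝ᵥ xyChain L τ γ μ f ≤ |f| ⬝ᵥ xyChain L 1 γ μ |f| := by
  rw [xyChain_one]
  refine dotProduct_hopping_le_abs _ (fun k η => ?_) _ f
  rw [abs_mul, abs_of_pos (bondRate_pos hγ k η)]
  refine mul_le_of_le_one_left (bondRate_pos hγ k η).le ?_
  unfold bondSign
  split_ifs
  exacts [hτ, abs_one.le]

namespace IsMaxRayleigh

variable (hΛ : IsMaxRayleigh (xyChain L 1 γ μ) (supportedOn (sector L σ)) Λ)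

include hΛ

lemma add_le_traceNorm (hL : 2 ≤ L) (hσθ : σ * θ = -1) (hT : IsTraceNorm (xyMatrix L γ θ) T) :
    Λ + L * (μ + 1 / 2) ≤ T := by
  obtain ⟨-, φ, hφ, hφ₀, hΛφ⟩ := hΛ
  have hle := isMajorana_jw.dotProduct_form_le hT φ
  rw [dotProduct_majoranaForm_xyMatrix hL γ μ hφ, hσθ, neg_neg, hΛφ, ← add_mul] at hle
  exact le_of_mul_le_mul_right hle (dotProduct_self_pos hφ₀)

lemma le_add_of_dotProduct_form_eq (hL : 2 ≤ L) (hγ : 0 < γ) (hσθ : |σ * θ| ≤ 1)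
    {Ω : Config L → ℝ} (hΩ₀ : Ω ≠ 0) (hΩ : parityOp L Ω = σ • Ω)
    (hT : Ω ⬝ᵥ majoranaForm jwA jwB (xyMatrix L γ θ) Ω = T * (Ω ⬝ᵥ Ω)) :
    T ≤ Λ + L * (μ + 1 / 2) := by
  rw [parityOp_eq_smul_iff] at hΩ
  refine le_of_mul_le_mul_right ?_ (dotProduct_self_pos hΩ₀)
  rw [← hT, dotProduct_majoranaForm_xyMatrix hL γ μ hΩ, add_mul, ← dotProduct_abs_self Ω]
  gcongr
  exact (dotProduct_xyChain_le_abs hγ μ (by rwa [abs_neg]) Ω).trans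
    (hΛ.1 _ (abs_mem_supportedOn hΩ))

end IsMaxRayleigh

lemma vecMul_one_xyMatrix_one (L : ℕ) (γ : ℝ) : Matrix.vecMul 1 (xyMatrix L γ 1) = 0 := by
  have hshift : Matrix.vecMul 1 (shiftMatrix L 1) = 1 := funext fun l => by
    rw [Matrix.vecMul, dotProduct, ← Equiv.sum_comp (finRotate L).symm]
    simp only [shiftMatrix, Matrix.of_apply, bondSign_one, Equiv.apply_symm_apply]
    simp
  have htranspose : Matrix.vecMul 1 (shiftMatrix L 1).transpose = 1 := funext fun l => by
    simp [Matrix.vecMul, dotProduct, shiftMatrix, bondSign_one, -finRotate_apply]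
  simp only [xyMatrix, Matrix.vecMul_sub, Matrix.vecMul_smul, Matrix.vecMul_one, hshift,
    htranspose]
  module

variable {Λo Λe Tp Ta : ℝ}

/-- The zero mode of the periodic fermions makes their ground state available in both sectors. -/
lemma IsMaxRayleigh.periodic_le_add (hL : 2 ≤ L) (hγ : 0 < γ) (hσ : |σ| = 1)
    (hΛ : IsMaxRayleigh (xyChain L 1 γ μ) (supportedOn (sector L σ)) Λ)
    (hTp : IsTraceNorm (xyMatrix L γ 1) Tp) : Tp ≤ Λ + L * (μ + 1 / 2) := by
  have : NeZero L := ⟨by omega⟩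
  obtain ⟨φ, hφ, hφ₀, -⟩ := hΛ.2
  obtain ⟨Ω, hΩ₀, hΩ, hform⟩ := isMajorana_jw.exists_dotProduct_form_eq_of_zero_mode hTp
    (fun _ => parityOp_mul_pauliString _ _) (fun _ => parityOp_mul_pauliString _ _) hφ₀ hσ
    (parityOp_eq_smul_iff.2 hφ) one_ne_zero (vecMul_one_xyMatrix_one L γ) hσ
  exact hΛ.le_add_of_dotProduct_form_eq hL hγ (by rw [mul_one, hσ]) hΩ₀ hΩ hform

theorem IsMaxRayleigh.odd_add_eq_periodic (hL : 2 ≤ L) (hγ : 0 < γ)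
    (hΛ : IsMaxRayleigh (xyChain L 1 γ μ) (supportedOn (sector L (-1))) Λ)
    (hTp : IsTraceNorm (xyMatrix L γ 1) Tp) : Λ + L * (μ + 1 / 2) = Tp :=
  le_antisymm (hΛ.add_le_traceNorm hL (mul_one _) hTp)
    (hΛ.periodic_le_add hL hγ (by simp) hTp)

/-- If the antiperiodic fermions attain their ground state at odd parity, the diamagnetic inequality
bounds its energy by the periodic one, which the zero mode makes available in the even sector. -/
theorem IsMaxRayleigh.even_add_eq_antiperiodic (hL : 2 ≤ L) (hγ : 0 < γ)
    (hΛe : IsMaxRayleigh (xyChain L 1 γ μ) (supportedOn (sector L 1)) Λe)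
    (hΛo : IsMaxRayleigh (xyChain L 1 γ μ) (supportedOn (sector L (-1))) Λo)
    (hTp : IsTraceNorm (xyMatrix L γ 1) Tp) (hTa : IsTraceNorm (xyMatrix L γ (-1)) Ta) :
    Λe + L * (μ + 1 / 2) = Ta := by
  refine le_antisymm (hΛe.add_le_traceNorm hL (by norm_num) hTa) ?_
  obtain ⟨φ, hφ, hφ₀, -⟩ := hΛe.2
  obtain ⟨Ω, τ, hΩ₀, hτ, hΩ, hform⟩ := isMajorana_jw.exists_dotProduct_form_eq hTa
    (fun _ => parityOp_mul_pauliString _ _) (fun _ => parityOp_mul_pauliString _ _) hφ₀ abs_one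
    (parityOp_eq_smul_iff.2 hφ)
  rcases eq_or_eq_neg_of_abs_eq hτ with rfl | rfl
  · exact hΛe.le_add_of_dotProduct_form_eq hL hγ (by simp) hΩ₀ hΩ hform
  · calc Ta ≤ Λo + L * (μ + 1 / 2) :=
          hΛo.le_add_of_dotProduct_form_eq hL hγ (by simp) hΩ₀ hΩ hform
      _ = Tp := hΛo.odd_add_eq_periodic hL hγ hTp
      _ ≤ Λe + L * (μ + 1 / 2) := hΛe.periodic_le_add hL hγ abs_one hTp

end LargestEigenvalue

section Symmetrization

variable {L : ℕ}

lemma spinProd_univ_eq_neg_one_pow (η : Config L) :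
    spinProd Finset.univ η = (-1) ^ particleNumber η := by
  rw [particleNumber, ← Finset.prod_pow_eq_pow_sum]
  refine Finset.prod_congr rfl fun k _ => ?_
  unfold spin occ
  cases η k <;> simp

lemma particleNumber_flipAt (j : Fin L) (η : Config L) :
    particleNumber (flipAt j η) + 2 * occ η j = particleNumber η + 1 := by
  have hrest : ∑ i ∈ Finset.univ.erase j, occ (flipAt j η) i = ∑ i ∈ Finset.univ.erase j, occ η i :=
    Finset.sum_congr rfl fun i hi => by
      rw [occ, flipAt_apply, if_neg (Finset.ne_of_mem_erase hi), occ]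
  rw [particleNumber, particleNumber, ← Finset.add_sum_erase _ _ (Finset.mem_univ j), hrest,
    ← Finset.add_sum_erase _ (occ η) (Finset.mem_univ j)]
  cases h : η j <;> simp [occ, flipAt_apply, h] <;> ring

lemma particleNumber_flip (hL : 2 ≤ L) (k : Fin L) (η : Config L) :
    particleNumber (flip η k) + 2 * (occ η k + occ η (finRotate L k)) = particleNumber η + 2 := by
  have hfirst := particleNumber_flipAt k η
  have hsecond := particleNumber_flipAt (finRotate L k) (flipAt k η)
  have hocc : occ (flipAt k η) (finRotate L k) = occ η (finRotate L k) := by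
    rw [occ, flipAt_apply, if_neg (finRotate_ne hL k), occ]
  rw [hocc, ← flip_eq_flipAt hL] at hsecond
  omega

/-- Conjugation by the weight `d ^ N` symmetrizes the tilted rates `(1 - ν) / 2`, `1 / 2`,
`(1 + ν) / 2` for `0`, `1`, `2` particles on the bond. -/
lemma tilted_rate_mul_pow_particleNumber_flip (hL : 2 ≤ L) {ν γ d : ℝ}
    (hd : d ^ 2 * (1 - ν) = γ) (hd' : d ^ 2 * γ = 1 + ν) (k : Fin L) (η : Config L) :
    ((1 - ν) / 2 + 1 / 2 * ν * ((occ η k : ℝ) + occ η (finRotate L k))) *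
      d ^ particleNumber (flip η k) = d ^ particleNumber η * bondRate γ k η := by
  have hN := particleNumber_flip hL k η
  unfold bondRate
  cases hk : η k <;> cases hk' : η (finRotate L k) <;>
    simp only [occ, hk, hk', spin, if_true, if_false, Bool.false_eq_true] at hN ⊢
  · rw [show particleNumber (flip η k) = particleNumber η + 2 by omega, pow_add]
    push_cast
    linear_combination d ^ particleNumber η / 2 * hd
  · rw [show particleNumber (flip η k) = particleNumber η by omega]
    push_cast
    ring
  · rw [show particleNumber (flip η k) = particleNumber η by omega]
    push_cast
    ring
  · rw [show particleNumber η = particleNumber (flip η k) + 2 by omega, pow_add]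
    push_cast
    linear_combination -d ^ particleNumber (flip η k) / 2 * hd'

lemma hopping_mul_of_rate_mul_eq {κ X : Type*} [Fintype κ] {F : κ → X → X} {r r' : κ → X → ℝ}
    {W : X → ℝ} (h : ∀ k x, r k x * W (F k x) = W x * r' k x) (D f : X → ℝ) :
    hopping F r D (W * f) = W * hopping F r' D f := by
  funext x
  simp only [hopping_apply, Pi.mul_apply, ← mul_assoc, h, mul_sub, Finset.mul_sum,
    mul_comm (D x)]

lemma tiltedGenerator_pow_particleNumber_mul (hL : 2 ≤ L) {ν : ℝ} (hν₁ : ν < 1) {γ d : ℝ}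
    (hγ : γ ^ 2 = 1 - ν ^ 2) (hd : d ^ 2 * (1 - ν) = γ) {Λ : ℝ} {φ : Config L → ℝ}
    (hφ : xyChain L 1 γ ((1 - ν) / 2) φ = Λ • φ) :
    tiltedGenerator L (1 / 2) ((1 - ν) / 2) ν ((fun η => d ^ particleNumber η) * φ) =
      Λ • ((fun η => d ^ particleNumber η) * φ) := by
  have hd' : d ^ 2 * γ = 1 + ν := by
    refine mul_left_cancel₀ (sub_ne_zero.2 hν₁.ne') ?_
    linear_combination γ * hd + hγ
  rw [tiltedGenerator,
    hopping_mul_of_rate_mul_eq (tilted_rate_mul_pow_particleNumber_flip hL hd hd'), ← xyChain_one,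
    hφ, mul_smul_comm]

lemma exists_sq_mul_eq {ν γ : ℝ} (hν₁ : ν < 1) (hγ : 0 < γ) :
    ∃ d : ℝ, 0 < d ∧ d ^ 2 * (1 - ν) = γ := by
  have hν : 0 < 1 - ν := sub_pos.2 hν₁
  refine ⟨Real.sqrt (γ / (1 - ν)), Real.sqrt_pos.2 (div_pos hγ hν), ?_⟩
  rw [Real.sq_sqrt (div_pos hγ hν).le, div_mul_cancel₀ _ hν.ne']

lemma tendsto_log_activityMGF {ν : ℝ} (hL : 2 ≤ L) (hν₀ : 0 ≤ ν) (hν₁ : ν ≤ 1) {σ Λ : ℝ}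
    {v : Config L → ℝ} (hv : tiltedGenerator L (1 / 2) ((1 - ν) / 2) ν v = Λ • v)
    (hv₀ : ∀ η ∈ sector L σ, 0 < v η) {η : Config L} (hη : η ∈ sector L σ) :
    Tendsto (fun t => Real.log (activityMGF L (1 / 2) ((1 - ν) / 2) η
      (criticalPoint (1 / 2) ((1 - ν) / 2)) t) / (L * t)) atTop (𝓝 (Λ / L)) := by
  have hexp : EReal.exp (criticalPoint (1 / 2) ((1 - ν) / 2)) = ENNReal.ofReal ν := by
    rw [exp_criticalPoint]
    congr 1
    ring
  simp only [activityMGF_eq_expAction hν₀ hν₁ hexp, mul_comm (L : ℝ), ← div_div]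
  refine (tendsto_log_expAction_div (mapsTo_flip_sector hL σ) (fun k ζ _ => ?_) hv hv₀
    (fun _ _ => one_pos) hη).div_const _
  have : 0 ≤ (1 - ν) / 2 := by linarith
  positivity

lemma even_iff_mem_sector (η : Config L) : Even (particleNumber η) ↔ η ∈ sector L 1 := by
  rw [sector, Set.mem_ofPred_eq, spinProd_univ_eq_neg_one_pow, neg_one_pow_eq_one_iff_even]
  norm_num

lemma odd_iff_mem_sector (η : Config L) : Odd (particleNumber η) ↔ η ∈ sector L (-1) := by
  rw [sector, Set.mem_ofPred_eq, spinProd_univ_eq_neg_one_pow, neg_one_pow_eq_neg_one_iff_odd]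
  norm_num

end Symmetrization

section CumulantGF

variable {L : ℕ} {ν : ℝ}

lemma tendsto_log_activityMGF_of_xyChain (hL : 2 ≤ L) (hν₀ : 0 ≤ ν) (hν₁ : ν < 1) {γ : ℝ}
    (hγ₀ : 0 < γ) (hγ : γ ^ 2 = 1 - ν ^ 2) {σ Λ : ℝ} {φ : Config L → ℝ}
    (hφ₀ : ∀ η ∈ sector L σ, 0 < φ η) (hφ : xyChain L 1 γ ((1 - ν) / 2) φ = Λ • φ)
    {η : Config L} (hη : η ∈ sector L σ) :
    Tendsto (fun t => Real.log (activityMGF L (1 / 2) ((1 - ν) / 2) η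
      (criticalPoint (1 / 2) ((1 - ν) / 2)) t) / (L * t)) atTop (𝓝 (Λ / L)) := by
  obtain ⟨d, hd₀, hd⟩ := exists_sq_mul_eq hν₁ hγ₀
  exact tendsto_log_activityMGF hL hν₀ hν₁.le
    (tiltedGenerator_pow_particleNumber_mul hL hν₁ hγ hd hφ)
    (fun ζ hζ => mul_pos (pow_pos hd₀ _) (hφ₀ ζ hζ)) hη

lemma isTraceNorm_xyMatrix_periodic [NeZero L] {γ : ℝ} (hγ : γ ^ 2 = 1 - ν ^ 2) :
    IsTraceNorm (xyMatrix L γ 1) (dispersionSum ν L 0) := by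
  rw [← sum_norm_xySymbol_momentum hγ le_rfl zero_le_one]
  exact (isMomenta_periodic L).isTraceNorm_xyMatrix γ

lemma isTraceNorm_xyMatrix_antiperiodic {γ : ℝ} (hγ : γ ^ 2 = 1 - ν ^ 2) :
    IsTraceNorm (xyMatrix L γ (-1)) (dispersionSum ν L (1 / 2)) := by
  rw [← sum_norm_xySymbol_momentum hγ (by norm_num) (by norm_num)]
  exact (isMomenta_antiperiodic L).isTraceNorm_xyMatrix γ

theorem isCumulantGF_even_and_odd (hL : 2 ≤ L) (hν₀ : 0 ≤ ν) (hν₁ : ν < 1) :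
    IsCumulantGF L (1 / 2) ((1 - ν) / 2) (criticalPoint (1 / 2) ((1 - ν) / 2)) Even
        (dispersionSum ν L (1 / 2) / L - (1 - ν / 2)) ∧
      IsCumulantGF L (1 / 2) ((1 - ν) / 2) (criticalPoint (1 / 2) ((1 - ν) / 2)) Odd
        (dispersionSum ν L 0 / L - (1 - ν / 2)) := by
  have : NeZero L := ⟨by omega⟩
  have hL₀ : (L : ℝ) ≠ 0 := NeZero.ne _
  have hγ₀ : 0 < Real.sqrt (1 - ν ^ 2) := Real.sqrt_pos.2 (by nlinarith)
  have hγ : Real.sqrt (1 - ν ^ 2) ^ 2 = 1 - ν ^ 2 := Real.sq_sqrt (by nlinarith)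
  obtain ⟨Λe, φe, hΛe, hφe₀, hφe⟩ :=
    exists_pos_eigenvector_isMaxRayleigh_xyChain hL hγ₀ ((1 - ν) / 2) abs_one
  obtain ⟨Λo, φo, hΛo, hφo₀, hφo⟩ :=
    exists_pos_eigenvector_isMaxRayleigh_xyChain hL hγ₀ ((1 - ν) / 2) (σ := -1) (by simp)
  have hTp := isTraceNorm_xyMatrix_periodic (L := L) hγ
  have he := hΛe.even_add_eq_antiperiodic hL hγ₀ hΛo hTp (isTraceNorm_xyMatrix_antiperiodic hγ)
  have ho := hΛo.odd_add_eq_periodic hL hγ₀ hTp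
  refine ⟨fun η hη => ?_, fun η hη => ?_⟩
  · convert tendsto_log_activityMGF_of_xyChain hL hν₀ hν₁ hγ₀ hγ hφe₀ hφe
      ((even_iff_mem_sector η).1 hη) using 2
    rw [← he]
    field
  · convert tendsto_log_activityMGF_of_xyChain hL hν₀ hν₁ hγ₀ hγ hφo₀ hφo
      ((odd_iff_mem_sector η).1 hη) using 2
    rw [← ho]
    field

/-- At `ν = 1` the dynamics is not tilted, so the constant function is the eigenvector. -/
theorem isCumulantGF_one (hL : 2 ≤ L) (parity : ℕ → Prop) :
    IsCumulantGF L (1 / 2) ((1 - 1) / 2) (criticalPoint (1 / 2) ((1 - 1) / 2)) parity 0 := by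
  intro η _
  have hone : tiltedGenerator L (1 / 2) ((1 - 1) / 2) 1 1 = (0 : ℝ) • 1 := by
    funext ζ
    simp [tiltedGenerator, hopping_apply, exitRate]
  simpa using tendsto_log_activityMGF hL zero_le_one le_rfl hone (fun _ _ => one_pos)
    (show η ∈ sector L (spinProd Finset.univ η) from rfl)

end CumulantGF

section EulerMaclaurin

variable {f : ℝ → ℝ} {a b C : ℝ}

lemma hasDerivAt_iteratedDeriv (hf : ContDiff ℝ 4 f) {n : ℕ} (hn : n < 4) (x : ℝ) :
    HasDerivAt (iteratedDeriv n f) (iteratedDeriv (n + 1) f x) x := by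
  rw [iteratedDeriv_succ]
  exact (hf.differentiable_iteratedDeriv n (by exact_mod_cast hn) x).hasDerivAt

/-- Integrate `(f''' k - f'' k' + f' k'' - f k''')' = f'''' k - f` for the Peano kernel
`k = (x - a)² (b - x)² / 24`. -/
lemma trapezoidal_error_one_sub_eq (hf : ContDiff ℝ 4 f) (a b : ℝ) :
    trapezoidal_error f 1 a b - (b - a) ^ 2 / 12 * (deriv f b - deriv f a) =
      -∫ x in a..b, iteratedDeriv 4 f x * ((x - a) ^ 2 * (b - x) ^ 2 / 24) := by
  set Ψ : ℝ → ℝ := fun x =>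
    iteratedDeriv 3 f x * ((x - a) ^ 2 * (b - x) ^ 2 / 24)
      - iteratedDeriv 2 f x * ((x - a) * (b - x) * (a + b - 2 * x) / 12)
      + iteratedDeriv 1 f x * (((a + b - 2 * x) ^ 2 - 2 * (x - a) * (b - x)) / 12)
      + iteratedDeriv 0 f x * ((a + b - 2 * x) / 2) with hΨ
  have hderiv (x : ℝ) :
      HasDerivAt Ψ (iteratedDeriv 4 f x * ((x - a) ^ 2 * (b - x) ^ 2 / 24) - f x) x := by
    have hl : HasDerivAt (fun x => x - a) 1 x := (hasDerivAt_id x).sub_const a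
    have hr : HasDerivAt (fun x => b - x) (-1) x := (hasDerivAt_id x).const_sub b
    have hm : HasDerivAt (fun x => a + b - 2 * x) (-2) x := by
      simpa using ((hasDerivAt_id x).const_mul 2).const_sub (a + b)
    refine (((((hasDerivAt_iteratedDeriv hf (by norm_num : 3 < 4) x).mul
      (((hl.pow 2).mul (hr.pow 2)).div_const 24)).sub
      ((hasDerivAt_iteratedDeriv hf (by norm_num : 2 < 4) x).mul
        (((hl.mul hr).mul hm).div_const 12))).add
      ((hasDerivAt_iteratedDeriv hf (by norm_num : 1 < 4) x).mul
        (((hm.pow 2).sub ((hl.const_mul 2).mul hr)).div_const 12))).add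
      ((hasDerivAt_iteratedDeriv hf (by norm_num : 0 < 4) x).mul
        (hm.div_const 2))).congr_deriv ?_
    simp only [iteratedDeriv_zero, Pi.mul_apply, Pi.pow_apply, Pi.sub_apply]
    ring
  have hint : Continuous fun x => iteratedDeriv 4 f x * ((x - a) ^ 2 * (b - x) ^ 2 / 24) :=
    (hf.continuous_iteratedDeriv 4 le_rfl).mul (by fun_prop)
  have hFTC := intervalIntegral.integral_eq_sub_of_hasDerivAt (fun x _ => hderiv x)
    ((hint.sub hf.continuous).intervalIntegrable a b)
  rw [intervalIntegral.integral_sub (hint.intervalIntegrable a b)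
    (hf.continuous.intervalIntegrable a b)] at hFTC
  rw [trapezoidal_error, trapezoidal_integral_one]
  simp only [hΨ, iteratedDeriv_zero, iteratedDeriv_one] at hFTC
  linear_combination hFTC

lemma abs_trapezoidal_error_one_sub_le (hf : ContDiff ℝ 4 f) (hab : a ≤ b)
    (hC : ∀ x ∈ Set.Icc a b, |iteratedDeriv 4 f x| ≤ C) :
    |trapezoidal_error f 1 a b - (b - a) ^ 2 / 12 * (deriv f b - deriv f a)| ≤
      C * (b - a) ^ 5 / 24 := by
  rw [trapezoidal_error_one_sub_eq hf, abs_neg, ← Real.norm_eq_abs]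
  refine (intervalIntegral.norm_integral_le_of_norm_le_const
    (C := C * ((b - a) ^ 2 * (b - a) ^ 2 / 24)) fun x hx => ?_).trans_eq ?_
  · rw [Set.uIoc_of_le hab] at hx
    have hleft : 0 ≤ x - a := sub_nonneg.2 hx.1.le
    have hright : 0 ≤ b - x := sub_nonneg.2 hx.2
    rw [norm_mul, Real.norm_of_nonneg (show 0 ≤ (x - a) ^ 2 * (b - x) ^ 2 / 24 by positivity)]
    gcongr
    · exact (abs_nonneg _).trans (hC a (Set.left_mem_Icc.2 hab))
    · exact hC x (Set.Ioc_subset_Icc_self hx)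
    · exact hx.2
    · exact hx.1.le
  · rw [abs_of_nonneg (sub_nonneg.2 hab)]
    ring

theorem abs_trapezoidal_error_sub_le (hf : ContDiff ℝ 4 f) (hab : a ≤ b)
    (hC : ∀ x ∈ Set.Icc a b, |iteratedDeriv 4 f x| ≤ C) {N : ℕ} (hN : 0 < N) :
    |trapezoidal_error f N a b - ((b - a) / N) ^ 2 / 12 * (deriv f b - deriv f a)| ≤
      C * (b - a) ^ 5 / (24 * N ^ 4) := by
  have hN₀ : (N : ℝ) ≠ 0 := by positivity
  set h := (b - a) / N with hh
  have hh₀ : 0 ≤ h := div_nonneg (sub_nonneg.2 hab) N.cast_nonneg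
  have hb : a + N * h = b := by rw [hh]; field
  have hcell (i : ℕ) (hi : i ∈ Finset.range N) :
      |trapezoidal_error f 1 (a + i * h) (a + (i + 1) * h)
        - h ^ 2 / 12 * (deriv f (a + (i + 1) * h) - deriv f (a + i * h))| ≤ C * h ^ 5 / 24 := by
    have hlength : a + (i + 1) * h - (a + i * h) = h := by ring
    have hi' : ((i : ℝ) + 1) * h ≤ N * h :=
      mul_le_mul_of_nonneg_right (by exact_mod_cast Finset.mem_range.1 hi) hh₀
    have hcell := abs_trapezoidal_error_one_sub_le hf (a := a + i * h) (b := a + (i + 1) * h)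
      (by linarith) fun x hx => hC x ⟨le_trans (le_add_of_nonneg_right (by positivity)) hx.1,
        hx.2.trans (by linarith)⟩
    rwa [hlength] at hcell
  have hsum : ∑ i ∈ Finset.range N, (trapezoidal_error f 1 (a + i * h) (a + (i + 1) * h)
      - h ^ 2 / 12 * (deriv f (a + (i + 1) * h) - deriv f (a + i * h))) =
      trapezoidal_error f N a b - h ^ 2 / 12 * (deriv f b - deriv f a) := by
    have htelescope := Finset.sum_range_sub (fun i : ℕ => deriv f (a + i * h)) N
    push_cast at htelescope
    rw [Finset.sum_sub_distrib, ← Finset.mul_sum, htelescope,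
      sum_trapezoidal_error_adjacent_intervals hN (hf.continuous.intervalIntegrable _ _), hb]
    simp
  calc _ ≤ ∑ _i ∈ Finset.range N, C * h ^ 5 / 24 := by
        rw [← hsum]
        exact (Finset.abs_sum_le_sum_abs _ _).trans (Finset.sum_le_sum hcell)
    _ = _ := by
        rw [Finset.sum_const, Finset.card_range, nsmul_eq_mul, hh]
        field

end EulerMaclaurin

section Dispersion

variable {ν : ℝ}

lemma radicand_pos (hν₀ : 0 ≤ ν) (hν₁ : ν < 1) {u : ℝ} (hu : |u| ≤ 1) :
    0 < 1 - ν ^ 2 * u ^ 2 := by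
  have hu' : u ^ 2 ≤ 1 := (sq_le_one_iff_abs_le_one u).2 hu
  nlinarith

lemma contDiff_sqrt_radicand (hν₀ : 0 ≤ ν) (hν₁ : ν < 1) :
    ContDiff ℝ 4 fun x => Real.sqrt (1 - ν ^ 2 * Real.cos (Real.pi * x) ^ 2) :=
  ContDiff.sqrt (by fun_prop) fun _ => (radicand_pos hν₀ hν₁ (Real.abs_cos_le_one _)).ne'

lemma contDiff_dispersion (hν₀ : 0 ≤ ν) (hν₁ : ν < 1) : ContDiff ℝ 4 (dispersion ν) :=
  ContDiff.mul (by fun_prop) (contDiff_sqrt_radicand hν₀ hν₁)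

lemma deriv_dispersion_of_sin_eq_zero (hν₀ : 0 ≤ ν) (hν₁ : ν < 1) {x : ℝ}
    (hx : Real.sin (Real.pi * x) = 0) :
    deriv (dispersion ν) x =
      Real.pi * Real.cos (Real.pi * x) * Real.sqrt (1 - ν ^ 2 * Real.cos (Real.pi * x) ^ 2) := by
  have hsin := ((hasDerivAt_id x).const_mul Real.pi).sin
  have hsqrt := ((contDiff_sqrt_radicand hν₀ hν₁).differentiable (by norm_num) x).hasDerivAt
  refine ((hsin.mul hsqrt).congr_deriv ?_).deriv
  simp only [id, hx]
  ring

lemma hasDerivAt_mul_sqrt_add_arcsin (hν : 0 < ν) (hν₁ : ν < 1) {u : ℝ} (hu : |u| ≤ 1) :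
    HasDerivAt (fun u => u * Real.sqrt (1 - ν ^ 2 * u ^ 2) + Real.arcsin (ν * u) / ν)
      (2 * Real.sqrt (1 - ν ^ 2 * u ^ 2)) u := by
  have hr := radicand_pos hν.le hν₁ hu
  have : 0 < Real.sqrt (1 - ν ^ 2 * u ^ 2) := Real.sqrt_pos.2 hr
  have hradicand : HasDerivAt (fun u : ℝ => 1 - ν ^ 2 * u ^ 2) (-(ν ^ 2 * (2 * u))) u := by
    simpa using (((hasDerivAt_id u).pow 2).const_mul (ν ^ 2)).const_sub 1
  obtain ⟨hlower, hupper⟩ : -1 < ν * u ∧ ν * u < 1 := by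
    rw [← abs_lt, ← sq_lt_one_iff_abs_lt_one, mul_pow]
    linarith
  have harcsin : HasDerivAt (fun u => Real.arcsin (ν * u))
      (1 / Real.sqrt (1 - (ν * u) ^ 2) * (ν * 1)) u :=
    (Real.hasDerivAt_arcsin hlower.ne' hupper.ne).comp u ((hasDerivAt_id u).const_mul ν)
  refine (((hasDerivAt_id u).mul (hradicand.sqrt hr.ne')).add
    (harcsin.div_const ν)).congr_deriv ?_
  rw [mul_pow, id]
  field_simp
  linear_combination -Real.sq_sqrt hr.le

theorem integral_dispersion (hν₀ : 0 ≤ ν) (hν₁ : ν < 1) :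
    ∫ x in (0 : ℝ)..1, dispersion ν x = kappaStar ν + (1 - ν / 2) := by
  have hcos (x : ℝ) := ((hasDerivAt_id x).const_mul Real.pi).cos
  have hint : IntervalIntegrable (dispersion ν) MeasureTheory.volume 0 1 :=
    (contDiff_dispersion hν₀ hν₁).continuous.intervalIntegrable 0 1
  rcases hν₀.eq_or_lt with rfl | hν
  · rw [intervalIntegral.integral_eq_sub_of_hasDerivAt (fun x _ =>
      ((hcos x).div_const (-Real.pi)).congr_deriv ?_) hint]
    · simp only [kappaStar, id, mul_one, mul_zero, Real.cos_pi, Real.cos_zero, if_true,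
        zero_pow two_ne_zero, sub_zero, Real.sqrt_one, zero_div]
      ring
    · simp [dispersion, Real.pi_ne_zero]
  · rw [intervalIntegral.integral_eq_sub_of_hasDerivAt (fun x _ =>
      ((HasDerivAt.comp (h := fun x => Real.cos (Real.pi * id x)) x
        (hasDerivAt_mul_sqrt_add_arcsin hν hν₁ (Real.abs_cos_le_one _)) (hcos x)).div_const
        (-(2 * Real.pi))).congr_deriv ?_) hint]
    · simp only [kappaStar, id, Function.comp_apply, mul_one, mul_zero, Real.cos_pi, Real.cos_zero,
        neg_one_sq, one_pow, mul_neg, Real.arcsin_neg, hν.ne', if_false]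
      field
    · rw [dispersion, id]
      field

lemma dispersionSum_zero_div_eq_trapezoidal_integral (ν : ℝ) {L : ℕ} (hL : 0 < L) :
    dispersionSum ν L 0 / L = trapezoidal_integral (dispersion ν) L 0 1 := by
  obtain ⟨n, rfl⟩ := Nat.exists_eq_add_one.2 hL
  rw [dispersionSum, trapezoidal_integral, Fin.sum_univ_succ,
    ← Fin.sum_univ_eq_sum_range fun k => dispersion ν _]
  simp only [dispersion, Fin.coe_ofNat_eq_mod, Nat.zero_mod, CharP.cast_eq_zero, add_zero,
    Nat.cast_add, Nat.cast_one, zero_div, mul_zero, Real.sin_zero, Real.cos_zero, one_pow, mul_one,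
    zero_mul, Fin.val_succ, zero_add, sub_zero, one_div, Real.sin_pi, Real.cos_pi, even_two,
    Even.neg_pow, Nat.add_one_sub_one]
  ring

lemma sum_range_two_mul {M : Type*} [AddCommMonoid M] (g : ℕ → M) (n : ℕ) :
    ∑ i ∈ Finset.range (2 * n), g i = ∑ i ∈ Finset.range n, (g (2 * i) + g (2 * i + 1)) := by
  induction n with
  | zero => simp
  | succ n ih =>
    rw [mul_add_one, Finset.sum_range_succ, Finset.sum_range_succ, ih, Finset.sum_range_succ,
      add_assoc]

lemma dispersionSum_half_add_dispersionSum_zero (ν : ℝ) (L : ℕ) :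
    dispersionSum ν L (1 / 2) + dispersionSum ν L 0 = dispersionSum ν (2 * L) 0 := by
  simp only [dispersionSum, add_zero]
  rw [Fin.sum_univ_eq_sum_range (fun q : ℕ => dispersion ν ((q + 1 / 2) / L)),
    Fin.sum_univ_eq_sum_range (fun q : ℕ => dispersion ν (q / L)),
    Fin.sum_univ_eq_sum_range (fun q : ℕ => dispersion ν (q / (2 * L : ℕ))), sum_range_two_mul,
    ← Finset.sum_add_distrib]
  refine Finset.sum_congr rfl fun q _ => ?_
  rw [add_comm]
  push_cast
  congr 2
  · rw [mul_div_mul_left _ _ two_ne_zero]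
  · rw [← mul_div_mul_left ((q : ℝ) + 1 / 2) _ two_ne_zero]
    ring

theorem dispersionSum_zero_isBigO (hν₀ : 0 ≤ ν) (hν₁ : ν < 1) :
    (fun L : ℕ => dispersionSum ν L 0 / L - (kappaStar ν + (1 - ν / 2) -
        Real.pi * Real.sqrt (1 - ν ^ 2) / (6 * (L : ℝ) ^ 2)))
      =O[atTop] fun L : ℕ => ((L : ℝ) ^ 4)⁻¹ := by
  have hf := contDiff_dispersion hν₀ hν₁
  obtain ⟨C, hC⟩ := isCompact_Icc.exists_bound_of_continuousOn (s := Set.Icc (0 : ℝ) 1)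
    (hf.continuous_iteratedDeriv 4 le_rfl).continuousOn
  refine IsBigO.of_bound (C / 24) ((eventually_gt_atTop 0).mono fun L hL => ?_)
  have herror := abs_trapezoidal_error_sub_le hf zero_le_one hC hL
  rw [trapezoidal_error, ← dispersionSum_zero_div_eq_trapezoidal_integral ν hL,
    integral_dispersion hν₀ hν₁, deriv_dispersion_of_sin_eq_zero hν₀ hν₁ (by simp),
    deriv_dispersion_of_sin_eq_zero hν₀ hν₁ (by simp)] at herror
  rw [norm_inv, Real.norm_eq_abs, Real.norm_of_nonneg (by positivity)]
  convert herror using 1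
  · congr 1
    simp only [mul_one, mul_zero, Real.cos_pi, Real.cos_zero, neg_one_sq, one_pow]
    ring
  · field

theorem dispersionSum_half_isBigO (hν₀ : 0 ≤ ν) (hν₁ : ν < 1) :
    (fun L : ℕ => dispersionSum ν L (1 / 2) / L - (kappaStar ν + (1 - ν / 2) +
        Real.pi * Real.sqrt (1 - ν ^ 2) / (12 * (L : ℝ) ^ 2)))
      =O[atTop] fun L : ℕ => ((L : ℝ) ^ 4)⁻¹ := by
  have hzero := dispersionSum_zero_isBigO hν₀ hν₁
  have hdouble := hzero.comp_tendsto (tendsto_id.const_mul_atTop' (by norm_num : 0 < 2))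
  have hscale : (fun L : ℕ => (((2 * L : ℕ) : ℝ) ^ 4)⁻¹)
      =O[atTop] fun L : ℕ => ((L : ℝ) ^ 4)⁻¹ := by
    simp only [Nat.cast_mul, mul_pow, mul_inv]
    exact isBigO_const_mul_self _ _ _
  refine (((hdouble.trans hscale).const_mul_left 2).sub hzero).congr_left fun L => ?_
  simp only [Function.comp_apply, id, ← dispersionSum_half_add_dispersionSum_zero]
  push_cast
  field

lemma kappaStar_one : kappaStar 1 = 0 := by
  simp only [kappaStar, one_ne_zero, if_false, Real.arcsin_one, one_pow, sub_self, Real.sqrt_zero]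
  field

end Dispersion

section Asymptotics

variable {ν : ℝ}

lemma inv_pow_isBigO_inv_pow_of_le {m n : ℕ} (h : m ≤ n) :
    (fun L : ℕ => ((L : ℝ) ^ n)⁻¹) =O[atTop] fun L : ℕ => ((L : ℝ) ^ m)⁻¹ := by
  refine IsBigO.of_bound' ((eventually_ge_atTop 1).mono fun L hL => ?_)
  have hL₁ : (1 : ℝ) ≤ L := by exact_mod_cast hL
  rw [norm_inv, norm_inv, Real.norm_of_nonneg (by positivity), Real.norm_of_nonneg (by positivity)]
  gcongr

theorem cumulantGF_even_isBigO (hν₀ : 0 ≤ ν) (hν₁ : ν < 1) :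
    (fun L : ℕ => dispersionSum ν L (1 / 2) / L - (1 - ν / 2) - (kappaStar ν +
        1 / soundVelocity ν * (Real.pi * centralCharge / (6 * (L : ℝ) ^ 2))))
      =O[atTop] fun L : ℕ => ((L : ℝ) ^ 4)⁻¹ :=
  (dispersionSum_half_isBigO hν₀ hν₁).congr_left fun L => by
    rw [soundVelocity, centralCharge, one_div_one_div]
    ring

theorem cumulantGF_odd_isBigO (hν₀ : 0 ≤ ν) (hν₁ : ν < 1) :
    (fun L : ℕ => dispersionSum ν L 0 / L - (1 - ν / 2) - (kappaStar ν -
        1 / soundVelocity ν * (Real.pi * centralCharge / (3 * (L : ℝ) ^ 2))))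
      =O[atTop] fun L : ℕ => ((L : ℝ) ^ 4)⁻¹ :=
  (dispersionSum_zero_isBigO hν₀ hν₁).congr_left fun L => by
    rw [soundVelocity, centralCharge, one_div_one_div]
    ring

end Asymptotics

end

end DLPAD

theorem mainTheorem3 (ν : ℝ) (hν₀ : 0 ≤ ν) (hν₁ : ν ≤ 1) :
    ∃ Kplus Kminus : ℕ → ℝ,
      (∀ L : ℕ, 2 ≤ L →
        DLPAD.IsCumulantGF L (1 / 2) ((1 - ν) / 2)
            (DLPAD.criticalPoint (1 / 2) ((1 - ν) / 2)) Even (Kplus L) ∧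
        DLPAD.IsCumulantGF L (1 / 2) ((1 - ν) / 2)
            (DLPAD.criticalPoint (1 / 2) ((1 - ν) / 2)) Odd (Kminus L)) ∧
      (fun L : ℕ => Kplus L -
          (DLPAD.kappaStar ν +
            1 / DLPAD.soundVelocity ν * (Real.pi * DLPAD.centralCharge / (6 * (L : ℝ) ^ 2))))
        =O[atTop] (fun L : ℕ => ((L : ℝ) ^ 4)⁻¹) ∧
      (fun L : ℕ => Kminus L -
          (DLPAD.kappaStar ν -
            1 / DLPAD.soundVelocity ν * (Real.pi * DLPAD.centralCharge / (3 * (L : ℝ) ^ 2))))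
        =O[atTop] (fun L : ℕ => ((L : ℝ) ^ 3)⁻¹) := by
  rcases hν₁.eq_or_lt with rfl | hν₁
  · refine ⟨fun _ => 0, fun _ => 0,
      fun L hL => ⟨DLPAD.isCumulantGF_one hL _, DLPAD.isCumulantGF_one hL _⟩, ?_, ?_⟩ <;>
    simpa [DLPAD.kappaStar_one, DLPAD.soundVelocity] using isBigO_zero _ _
  · exact ⟨_, _, fun L hL => DLPAD.isCumulantGF_even_and_odd hL hν₀ hν₁,
      DLPAD.cumulantGF_even_isBigO hν₀ hν₁,
      (DLPAD.cumulantGF_odd_isBigO hν₀ hν₁).trans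
        (DLPAD.inv_pow_isBigO_inv_pow_of_le (by norm_num))⟩
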